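/- Let $T>0$, $0<a'<a<\tfrac12$, $0<b'<b<\tfrac12$, and let $(s,t)\mapsto b_{s,t}$ be a bounded Borel function on $[0,T]^2$ with $\|b\|_\infty:=\sup_{[0,T]^2}|b_{s,t}|$. Let $$I^{\alpha,\beta}_{0+}f(x,y)=\frac{1}{\Gamma(\alpha)\Gamma(\beta)}\int_0^x\!\!\int_0^y (x-u)^{\alpha-1}(y-v)^{\beta-1}f(u,v)\,dv\,du,$$ $$D^{\alpha,\beta}_{0+}f(x,y)=\frac{1}{\Gamma(1-\alpha)\Gamma(1-\beta)}\frac{\partial^2}{\partial x\,\partial y}\int_0^x\!\!\int_0^y \frac{f(u,v)}{(x-u)^{\alpha}(y-v)^{\beta}}\,dv\,du$$ be the two-parameter left-sided Riemann--Liouville integral and derivative on $[0,T]^2$ (one-sided derivatives at the edges). For $n\in\mathbb N=\{0,1,2,\dots\}$ put $$f_n(s,t)=s^{a-a'}t^{b-b'}\Big(D^{a',b'}_{0+}\,s^{a'-a}t^{b'-b}\,I^{a,b}_{0+}\big(s^{a-a'}t^{b-b'}\,\cdot\,\big)\Big)^{n}\big(s^{a'}t^{b'}b_{s,t}\big),$$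 $$G^n=I^{a,b}_{0+}f_n,\qquad \mathcal J^n_{s,t}=s^{-a}t^{-b}\,|G^n(s,t)|,$$ where $\mathcal J^n_{s,t}:=0$ if $s=0$ or $t=0$, and $f_n(s,t):=0$ if $s=0$ or $t=0$. With $\alpha_n=(n+1)a-na'+1$ and $\beta_n=(n+1)b-nb'+1$ let $$\kappa_n=\frac{\Gamma(\alpha_n)\Gamma(\beta_n)}{\Gamma(\alpha_n+a)\Gamma(\beta_n+b)},\quad \tilde\kappa_n=\frac{\Gamma(\alpha_n)\Gamma(\beta_n)}{\Gamma(\alpha_n+a-a')\Gamma(\beta_n+b-b')},$$ $$\kappa'_n=\frac{\Gamma(\alpha_n+a)\Gamma(\beta_n+b)}{\Gamma(\alpha_n+2a-a')\Gamma(\beta_n+2b-b')},\quad \tilde\kappa'_n=\frac{\Gamma(\alpha_n+a-a')\Gamma(\beta_n+b-b')}{\Gamma(\alpha_n+2a-a')\Gamma(\beta_n+2b-b')},$$ $$d^{(n)}_1=\int_0^1\frac{|1-u^{a'-a}|}{(1-u)^{a'+1}}u^{\alpha_n+a-1}du,\qquad d^{(n)}_2=\int_0^1\frac{|1-u^{b'-b}|}{(1-u)^{b'+1}}u^{\beta_n+b-1}du,$$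 $$d_5=\int_0^1\frac{|1-v|^{b}+|1-v^{b}|}{(1-v)^{b'+1}}dv,\qquad d_6=\int_0^1\frac{|1-u|^{a}+|1-u^{a}|}{(1-u)^{a'+1}}du,$$ $$c_1=\frac{a'}{\Gamma(1-a')\Gamma(1-b')},\quad c_2=\frac{b'}{\Gamma(1-a')\Gamma(1-b')},\quad c_3=\frac{a'b'}{\Gamma(1-a')\Gamma(1-b')},\quad l_n=\frac{c_3\,(d_5d^{(n)}_1+d_6d^{(n)}_2)}{ab\,\Gamma(a)\Gamma(b)},$$ and define recursively $C_0=\|b\|_\infty$, $C^\star_0=\dfrac{\|b\|_\infty}{4}\,\dfrac{\Gamma(a)\Gamma(b)}{\Gamma(2a)\Gamma(2b)}$, $$C_{n+1}=\Big\{(1+c_3d^{(n)}_1d^{(n)}_2)\tilde\kappa_n+(c_1d^{(n)}_1+c_2d^{(n)}_2)\kappa_n+l_n\Big\}C_n,$$ $$C^\star_{n+1}=\Big\{\kappa'_n+\tilde\kappa'_n\big(c_1d^{(n)}_1+c_2d^{(n)}_2+c_3d^{(n)}_1d^{(n)}_2\big)\Big\}C^\star_n+l_nC_n.$$ Then for every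 $n\in\mathbb N$ the integral $I^{a,b}_{0+}f_n$ converges absolutely and the derivative $D^{a',b'}_{0+}\big(s^{a'-a}t^{b'-b}I^{a,b}_{0+}f_n\big)$ exists at every point of $(0,T]^2$ (so that all $f_n$ and $\mathcal J^n$ are well defined), and for all $s,t\in[0,T]$ $$|f_n(s,t)|\le C_n\,s^{(n+1)a-na'}\,t^{(n+1)b-nb'},\qquad \mathcal J^n_{s,t}\le C^\star_n\,s^{(n+1)a-na'}\,t^{(n+1)b-nb'}.$$ -/

import Mathlib

open Set MeasureTheory

noncomputable section

/-- The kernel integral `∫₀ˣ ∫₀ʸ (x-u)^(α-1) (y-v)^(β-1) f(u,v) dv du / (Γ(α) Γ(β))`: the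
two-parameter left-sided Riemann–Liouville integral of order `(α, β)`. -/
def rlIntegral (α β : ℝ) (f : ℝ → ℝ → ℝ) (x y : ℝ) : ℝ :=
  1 / (Real.Gamma α * Real.Gamma β) *
    ∫ u in (0 : ℝ)..x, ∫ v in (0 : ℝ)..y, (x - u) ^ (α - 1) * (y - v) ^ (β - 1) * f u v

/-- The integral defining `rlIntegral α β f x y` converges absolutely. -/
def RLIntegrableAt (α β : ℝ) (f : ℝ → ℝ → ℝ) (x y : ℝ) : Prop :=
  IntegrableOn (fun z : ℝ × ℝ => (x - z.1) ^ (α - 1) * (y - z.2) ^ (β - 1) * f z.1 z.2)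
    (Ioc 0 x ×ˢ Ioc 0 y)

/-- The function that is differentiated in the Riemann–Liouville derivative of order `(α, β)`. -/
def rlPotential (α β : ℝ) (f : ℝ → ℝ → ℝ) (x y : ℝ) : ℝ :=
  ∫ u in (0 : ℝ)..x, ∫ v in (0 : ℝ)..y, f u v / ((x - u) ^ α * (y - v) ^ β)

/-- The two-parameter left-sided Riemann–Liouville derivative of order `(α, β)` of a function on
the square `[0,T]²` (one-sided derivatives at the edges of the square). -/
def rlDeriv (T α β : ℝ) (f : ℝ → ℝ → ℝ) (x y : ℝ) : ℝ :=
  1 / (Real.Gamma (1 - α) * Real.Gamma (1 - β)) *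
    derivWithin (fun x' => derivWithin (fun y' => rlPotential α β f x' y') (Icc 0 T) y)
      (Icc 0 T) x

/-- The Riemann–Liouville derivative `rlDeriv T α β f x y` exists in the classical sense: the
integrals in it converge absolutely and both partial derivatives exist. -/
def RLDifferentiableAt (T α β : ℝ) (f : ℝ → ℝ → ℝ) (x y : ℝ) : Prop :=
  (∀ x' ∈ Icc 0 T, ∀ y' ∈ Icc 0 T,
    IntegrableOn (fun z : ℝ × ℝ => f z.1 z.2 / ((x' - z.1) ^ α * (y' - z.2) ^ β))
      (Ioc 0 x' ×ˢ Ioc 0 y')) ∧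
  (∀ x' ∈ Icc 0 T,
    DifferentiableWithinAt ℝ (fun y' => rlPotential α β f x' y') (Icc 0 T) y) ∧
  DifferentiableWithinAt ℝ
    (fun x' => derivWithin (fun y' => rlPotential α β f x' y') (Icc 0 T) y) (Icc 0 T) x

/-- Multiplication of a function of `(s, t)` by the weight `s^p t^q`. -/
def weightMul (p q : ℝ) (g : ℝ → ℝ → ℝ) (s t : ℝ) : ℝ := s ^ p * t ^ q * g s t

/-- The operator `g ↦ D^{a',b'} (s^{a'-a} t^{b'-b} I^{a,b} (s^{a-a'} t^{b-b'} g))`. -/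
def neumannOp (T a a' b b' : ℝ) (g : ℝ → ℝ → ℝ) : ℝ → ℝ → ℝ :=
  rlDeriv T a' b' (weightMul (a' - a) (b' - b)
    (rlIntegral a b (weightMul (a - a') (b - b') g)))

/-- `f_n = s^{a-a'} t^{b-b'} (neumannOp)^n (s^{a'} t^{b'} h)`. -/
def fSeq (T a a' b b' : ℝ) (h : ℝ → ℝ → ℝ) (n : ℕ) : ℝ → ℝ → ℝ :=
  weightMul (a - a') (b - b') ((neumannOp T a a' b b')^[n] (weightMul a' b' h))

/-- `G^n = I^{a,b} f_n`. -/
def GSeq (T a a' b b' : ℝ) (h : ℝ → ℝ → ℝ) (n : ℕ) : ℝ → ℝ → ℝ :=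
  rlIntegral a b (fSeq T a a' b b' h n)

/-- `J^n_{s,t} = s^{-a} t^{-b} |G^n(s,t)|`. -/
def JSeq (T a a' b b' : ℝ) (h : ℝ → ℝ → ℝ) (n : ℕ) (s t : ℝ) : ℝ :=
  s ^ (-a) * t ^ (-b) * |GSeq T a a' b b' h n s t|

/-- `‖h‖_∞`, the supremum of `|h|` over the square `[0,T]²`. -/
def supNormSquare (T : ℝ) (h : ℝ → ℝ → ℝ) : ℝ :=
  sSup ((fun z : ℝ × ℝ => |h z.1 z.2|) '' (Icc 0 T ×ˢ Icc 0 T))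

/-- The exponent `(n+1) a - n a'`. -/
def gam (a a' : ℝ) (n : ℕ) : ℝ := ((n : ℝ) + 1) * a - (n : ℝ) * a'

/-- `α_n = (n+1) a - n a' + 1`; the sequence `β_n` is `alphaSeq b b'`. -/
def alphaSeq (a a' : ℝ) (n : ℕ) : ℝ := gam a a' n + 1

/-- `κ_n`. -/
def kap (a a' b b' : ℝ) (n : ℕ) : ℝ :=
  Real.Gamma (alphaSeq a a' n) / Real.Gamma (alphaSeq a a' n + a) *
    (Real.Gamma (alphaSeq b b' n) / Real.Gamma (alphaSeq b b' n + b))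

/-- `κ̃_n`. -/
def kapTilde (a a' b b' : ℝ) (n : ℕ) : ℝ :=
  Real.Gamma (alphaSeq a a' n) / Real.Gamma (alphaSeq a a' n + a - a') *
    (Real.Gamma (alphaSeq b b' n) / Real.Gamma (alphaSeq b b' n + b - b'))

/-- `κ'_n`. -/
def kapPrime (a a' b b' : ℝ) (n : ℕ) : ℝ :=
  Real.Gamma (alphaSeq a a' n + a) / Real.Gamma (alphaSeq a a' n + 2 * a - a') *
    (Real.Gamma (alphaSeq b b' n + b) / Real.Gamma (alphaSeq b b' n + 2 * b - b'))

/-- `κ̃'_n`. -/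
def kapTildePrime (a a' b b' : ℝ) (n : ℕ) : ℝ :=
  Real.Gamma (alphaSeq a a' n + a - a') / Real.Gamma (alphaSeq a a' n + 2 * a - a') *
    (Real.Gamma (alphaSeq b b' n + b - b') / Real.Gamma (alphaSeq b b' n + 2 * b - b'))

/-- `d_1^{(n)}`; the number `d_2^{(n)}` is `dSeq b b' n`. -/
def dSeq (a a' : ℝ) (n : ℕ) : ℝ :=
  ∫ u in (0 : ℝ)..1, |1 - u ^ (a' - a)| / (1 - u) ^ (a' + 1) * u ^ (alphaSeq a a' n + a - 1)

/-- `d_6`; the number `d_5` is `dConst b b'`. -/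
def dConst (a a' : ℝ) : ℝ :=
  ∫ u in (0 : ℝ)..1, (|1 - u| ^ a + |1 - u ^ a|) / (1 - u) ^ (a' + 1)

/-- `c_1`. -/
def c1 (a' b' : ℝ) : ℝ := a' / (Real.Gamma (1 - a') * Real.Gamma (1 - b'))

/-- `c_2`. -/
def c2 (a' b' : ℝ) : ℝ := b' / (Real.Gamma (1 - a') * Real.Gamma (1 - b'))

/-- `c_3`. -/
def c3 (a' b' : ℝ) : ℝ := a' * b' / (Real.Gamma (1 - a') * Real.Gamma (1 - b'))

/-- `l_n = c_3 (d_5 d_1^{(n)} + d_6 d_2^{(n)}) / (a b Γ(a) Γ(b))`. -/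
def lSeq (a a' b b' : ℝ) (n : ℕ) : ℝ :=
  c3 a' b' * (dConst b b' * dSeq a a' n + dConst a a' * dSeq b b' n) /
    (a * b * Real.Gamma a * Real.Gamma b)

/-- `r_n`. -/
def rSeq (a a' b b' : ℝ) (n : ℕ) : ℝ :=
  (1 + c3 a' b' * dSeq a a' n * dSeq b b' n) * kapTilde a a' b b' n +
    (c1 a' b' * dSeq a a' n + c2 a' b' * dSeq b b' n) * kap a a' b b' n +
    lSeq a a' b b' n

/-- `m_n`. -/
def mSeq (a a' b b' : ℝ) (n : ℕ) : ℝ :=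
  kapPrime a a' b b' n + kapTildePrime a a' b b' n *
    (c1 a' b' * dSeq a a' n + c2 a' b' * dSeq b b' n +
      c3 a' b' * dSeq a a' n * dSeq b b' n)

/-- `C_n`, started from `C_0 = N`. -/
def CSeq (a a' b b' N : ℝ) : ℕ → ℝ
  | 0 => N
  | n + 1 => rSeq a a' b b' n * CSeq a a' b b' N n

/-- `C*_n`, started from `C*_0 = (N / 4) Γ(a) Γ(b) / (Γ(2a) Γ(2b))`. -/
def CStarSeq (a a' b b' N : ℝ) : ℕ → ℝ
  | 0 => N / 4 * (Real.Gamma a * Real.Gamma b / (Real.Gamma (2 * a) * Real.Gamma (2 * b)))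
  | n + 1 => mSeq a a' b b' n * CStarSeq a a' b b' N n +
      lSeq a a' b b' n * CSeq a a' b b' N n

end

/-!
The operators of the theorem commute with dilations, and so do the weights up to powers. Hence, up
to powers of `x` and `y`, each of them averages `F (x w, y z)` over dilations `w`, `z` in `(0, 1)`
with respect to a product of finite measures (`dil₂`). Operators compose by multiplicative
convolution of the measures, a bound `C x^g y^g'` is multiplied by moments of the measures, and
identities between operators can be checked on moments, because a finite measure on the unit
interval is determined by its moments (`eq_of_forall_mom_eq`).

The fractional integral of order `a` has the density `(1 - w)^(a-1) / Γ(a)`, whose moments are Gamma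
quotients. Up to a power, the operator `D^{a'} x^(a'-a) I^a` is the difference of two positive
averages, `I^(a-a')` and the correction in the Marchaud form of the derivative that comes from the
weight; the latter averages `I^a f` with respect to `marchaudKernel`, which has the moment `d₁⁽ⁿ⁾`.
That the derivative exists at every point is seen as follows. The potential that is to be
differentiated is the primitive of this difference (`betaKernel_one_mconv_eq`, an identity between
Gamma functions), and averaging a bounded Borel function with an integrable density gives a function
that is continuous on `(0, ∞)`, since integrable densities are limits of continuous ones
(`isContKernel_unitDensity`). The tensor product of the one-variable operators is `derivOp`, and
`rlDeriv_weightMul_rlIntegral` identifies it with the derivative.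

Taking absolute values gives `|f_{n+1}| ≤ (A + c_{a'} d₁ A₀) (B + c_{b'} d₂ B₀) C_n x^.. y^..`, where
`A`, `A₀`, `B`, `B₀` are Gamma quotients and `c_r = r / Γ(1 - r)`. The Marchaud formula
`A = A₀ / Γ(1 - a') (1 + a' W)`, with `W` the integral of `(1 - w^m) / (1 - w)^(a'+1)`, turns this
into the factor in the recursion for `C_n`; the terms with `W` are absorbed by `l_n`, because
`A₀ Γ(1 + a) W ≤ 1 / (a - a')` and `d₆ ≥ 1 / (a - a') + d₁` (`mul_bounds_le_rSeq`). For `𝒥ⁿ`, the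
operator is moved past the fractional integral (`dil₂_weightMul_derivOp`), and the terms with `W`
are estimated through the bound on `f_n`, the others through the bound on `𝒥ⁿ`
(`mul_bounds_le_mSeq`).
-/

open scoped Topology

noncomputable section

/-! ### Finite measures on the unit interval and their moments -/

/-- A finite measure on `ℝ` concentrated on the open unit interval. -/
class IsUnitKernel (m : Measure ℝ) : Prop extends IsFiniteMeasure m where
  ae_mem : ∀ᵐ w ∂m, w ∈ Ioo (0 : ℝ) 1

/-- The moment `∫ w ^ s dm(w)`. -/
def mom (m : Measure ℝ) (s : ℝ) : ℝ := ∫ w, w ^ s ∂m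

lemma rpow_le_one_of_mem_Ioo {w s : ℝ} (hw : w ∈ Ioo (0 : ℝ) 1) (hs : 0 ≤ s) : w ^ s ≤ 1 :=
  Real.rpow_le_one hw.1.le hw.2.le hs

lemma integrable_rpow_of_isUnitKernel (m : Measure ℝ) [IsUnitKernel m] {s : ℝ} (hs : 0 ≤ s) :
    Integrable (fun w : ℝ => w ^ s) m := by
  refine Integrable.of_bound (C := 1) (by fun_prop) ?_
  filter_upwards [IsUnitKernel.ae_mem (m := m)] with w hw
  rw [Real.norm_of_nonneg (Real.rpow_nonneg hw.1.le s)]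
  exact rpow_le_one_of_mem_Ioo hw hs

lemma mom_nonneg (m : Measure ℝ) [IsUnitKernel m] (s : ℝ) : 0 ≤ mom m s := by
  refine integral_nonneg_of_ae ?_
  filter_upwards [IsUnitKernel.ae_mem (m := m)] with w hw
  exact Real.rpow_nonneg hw.1.le s

lemma mom_anti (m : Measure ℝ) [IsUnitKernel m] {s t : ℝ} (hs : 0 ≤ s) (hst : s ≤ t) :
    mom m t ≤ mom m s := by
  refine integral_mono_ae (integrable_rpow_of_isUnitKernel m (hs.trans hst))
    (integrable_rpow_of_isUnitKernel m hs) ?_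
  filter_upwards [IsUnitKernel.ae_mem (m := m)] with w hw
  exact Real.rpow_le_rpow_of_exponent_ge hw.1 hw.2.le hst

instance IsUnitKernel.mconv (m n : Measure ℝ) [IsUnitKernel m] [IsUnitKernel n] :
    IsUnitKernel (m.mconv n) where
  ae_mem := by
    have hmul : Measurable fun x : ℝ × ℝ => x.1 * x.2 := by fun_prop
    refine (ae_map_iff (p := fun w => w ∈ Ioo (0 : ℝ) 1) hmul.aemeasurable measurableSet_Ioo).2 ?_
    refine (Measure.ae_prod_iff_ae_ae (p := fun x : ℝ × ℝ => x.1 * x.2 ∈ Ioo (0 : ℝ) 1)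
      (measurableSet_Ioo.preimage hmul)).2 ?_
    filter_upwards [IsUnitKernel.ae_mem (m := m)] with w hw
    filter_upwards [IsUnitKernel.ae_mem (m := n)] with z hz
    exact ⟨mul_pos hw.1 hz.1, mul_lt_one_of_nonneg_of_lt_one_left hw.1.le hw.2 hz.2.le⟩

instance IsUnitKernel.add (m n : Measure ℝ) [IsUnitKernel m] [IsUnitKernel n] :
    IsUnitKernel (m + n) where
  ae_mem := (ae_add_measure_iff).2 ⟨IsUnitKernel.ae_mem, IsUnitKernel.ae_mem⟩

lemma IsUnitKernel.smul (m : Measure ℝ) [IsUnitKernel m] (c : NNReal) :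
    IsUnitKernel (c • m) where
  ae_mem := Measure.ae_smul_measure IsUnitKernel.ae_mem c

lemma mom_mconv (m n : Measure ℝ) [IsUnitKernel m] [IsUnitKernel n] {s : ℝ} (hs : 0 ≤ s) :
    mom (m.mconv n) s = mom m s * mom n s := by
  rw [mom, integral_mconv (integrable_rpow_of_isUnitKernel _ hs), mom, ← integral_mul_const]
  refine integral_congr_ae ?_
  filter_upwards [IsUnitKernel.ae_mem (m := m)] with w hw
  simp only [mom, ← integral_const_mul]
  refine integral_congr_ae ?_
  filter_upwards [IsUnitKernel.ae_mem (m := n)] with z hz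
  exact Real.mul_rpow hw.1.le hz.1.le

/-- The Hausdorff moment problem is determinate: a finite measure on the unit interval is
determined by its moments, by the Weierstrass approximation theorem. -/
lemma eq_of_forall_mom_eq (m n : Measure ℝ) [IsUnitKernel m] [IsUnitKernel n]
    (h : ∀ k : ℕ, mom m k = mom n k) : m = n := by
  have hint : ∀ (μ : Measure ℝ) [IsUnitKernel μ] (p : Polynomial ℝ),
      Integrable (fun w => p.eval w) μ := by
    intro μ _ p
    obtain ⟨C, hC⟩ := (isCompact_Icc (a := (0 : ℝ)) (b := 1)).exists_bound_of_continuousOn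
      p.continuous.continuousOn
    refine Integrable.of_bound (C := C) p.continuous.aestronglyMeasurable ?_
    filter_upwards [IsUnitKernel.ae_mem (m := μ)] with w hw using hC w (Ioo_subset_Icc_self hw)
  have hpoly : ∀ p : Polynomial ℝ, ∫ w, p.eval w ∂m = ∫ w, p.eval w ∂n := by
    intro p
    induction p using Polynomial.induction_on' with
    | add p q hp hq =>
      simp only [Polynomial.eval_add]
      rw [integral_add (hint m p) (hint m q), integral_add (hint n p) (hint n q), hp, hq]
    | monomial k c =>
      simp only [Polynomial.eval_monomial, integral_const_mul]
      have := h k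
      simp only [mom, Real.rpow_natCast] at this
      rw [this]
  refine ext_of_forall_integral_eq_of_IsFiniteMeasure fun f => ?_
  refine eq_of_forall_dist_le fun e he => ?_
  set K : ℝ := m.real univ + n.real univ + 1 with hK
  have hKpos : 0 < K := by positivity
  obtain ⟨p, hp⟩ := exists_polynomial_near_of_continuousOn 0 1 f f.continuous.continuousOn
    (e / K) (by positivity)
  have key : ∀ (μ : Measure ℝ) [IsUnitKernel μ],
      |∫ w, f w ∂μ - ∫ w, p.eval w ∂μ| ≤ e / K * μ.real univ := by
    intro μ _
    rw [← integral_sub (f.integrable μ) (hint μ p), ← Real.norm_eq_abs]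
    refine norm_integral_le_of_norm_le_const ?_
    filter_upwards [IsUnitKernel.ae_mem (m := μ)] with w hw
    rw [Real.norm_eq_abs, abs_sub_comm]
    exact (hp w (Ioo_subset_Icc_self hw)).le
  have h1 := key m
  have h2 := key n
  rw [hpoly p] at h1
  have h3 : e / K * m.real univ + e / K * n.real univ ≤ e := by
    rw [← mul_add, div_mul_eq_mul_div, div_le_iff₀ hKpos]
    exact mul_le_mul_of_nonneg_left (by linarith) he.le
  rw [Real.dist_eq]
  calc |∫ w, f w ∂m - ∫ w, f w ∂n|
      ≤ |∫ w, f w ∂m - ∫ w, p.eval w ∂n| + |∫ w, f w ∂n - ∫ w, p.eval w ∂n| := by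
        rw [abs_sub_comm (∫ w, f w ∂n)]
        exact abs_sub_le _ _ _
    _ ≤ e := by linarith

/-- The measure on the unit interval with density `k`. -/
def unitDensity (k : ℝ → ℝ) : Measure ℝ :=
  (volume.restrict (Ioo 0 1)).withDensity fun w => ENNReal.ofReal (k w)

section unitDensity

variable {k : ℝ → ℝ}

lemma integral_unitDensity (hk : Measurable k) (h0 : ∀ w ∈ Ioo (0 : ℝ) 1, 0 ≤ k w) (φ : ℝ → ℝ) :
    ∫ w, φ w ∂(unitDensity k) = ∫ w in Ioo (0 : ℝ) 1, k w * φ w := by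
  rw [unitDensity, integral_withDensity_eq_integral_toReal_smul (by fun_prop) (by simp)]
  refine setIntegral_congr_fun measurableSet_Ioo fun w hw => ?_
  simp [ENNReal.toReal_ofReal (h0 w hw)]

lemma isUnitKernel_unitDensity (hint : IntegrableOn k (Ioo 0 1)) :
    IsUnitKernel (unitDensity k) where
  toIsFiniteMeasure := isFiniteMeasure_withDensity_ofReal hint.hasFiniteIntegral
  ae_mem := (withDensity_absolutelyContinuous _ _).ae_le
    (ae_restrict_mem measurableSet_Ioo)

end unitDensity

/-- Euler's beta integral. -/
lemma integrableOn_and_integral_beta {p q : ℝ} (hp : 0 < p) (hq : 0 < q) :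
    IntegrableOn (fun w : ℝ => w ^ (p - 1) * (1 - w) ^ (q - 1)) (Ioo 0 1) ∧
      ∫ w in Ioo (0 : ℝ) 1, w ^ (p - 1) * (1 - w) ^ (q - 1) =
        Real.Gamma p * Real.Gamma q / Real.Gamma (p + q) := by
  have hc := Complex.betaIntegral_convergent (u := p) (v := q) (by simpa) (by simpa)
  rw [intervalIntegrable_iff_integrableOn_Ioo_of_le zero_le_one] at hc
  have heq : ∀ w ∈ Ioo (0 : ℝ) 1, (w : ℂ) ^ ((p : ℂ) - 1) * (1 - (w : ℂ)) ^ ((q : ℂ) - 1) =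
      ((w ^ (p - 1) * (1 - w) ^ (q - 1) : ℝ) : ℂ) := by
    intro w hw
    rw [Complex.ofReal_mul, Complex.ofReal_cpow hw.1.le, Complex.ofReal_cpow (by linarith [hw.2])]
    push_cast
    rfl
  have hc' : IntegrableOn (fun w : ℝ => ((w ^ (p - 1) * (1 - w) ^ (q - 1) : ℝ) : ℂ)) (Ioo 0 1) :=
    hc.congr_fun heq measurableSet_Ioo
  refine ⟨by simpa [IntegrableOn] using hc'.re, ?_⟩
  have h1 : ((∫ w in Ioo (0 : ℝ) 1, w ^ (p - 1) * (1 - w) ^ (q - 1) : ℝ) : ℂ) =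
      Complex.betaIntegral p q := by
    rw [Complex.betaIntegral, intervalIntegral.integral_of_le zero_le_one,
      integral_Ioc_eq_integral_Ioo, ← integral_complex_ofReal]
    exact (setIntegral_congr_fun measurableSet_Ioo heq).symm
  have h2 := ProbabilityTheory.beta_eq_betaIntegralReal p q hp hq
  rw [← h1, Complex.ofReal_re] at h2
  exact h2.symm

/-- The density of `betaKernel p q`. -/
def betaDensity (p q w : ℝ) : ℝ := w ^ q * (1 - w) ^ (p - 1) / Real.Gamma p

/-- The measure with density `w ^ q * (1 - w) ^ (p - 1) / Γ(p)` on the unit interval. The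
fractional integral of order `p` is `x ^ p` times averaging over dilations with respect to
`betaKernel p 0`; a weight `x ^ q` in front of the function turns it into `betaKernel p q`. -/
def betaKernel (p q : ℝ) : Measure ℝ := unitDensity (betaDensity p q)

lemma measurable_betaDensity (p q : ℝ) : Measurable (betaDensity p q) := by
  unfold betaDensity
  fun_prop

lemma betaDensity_nonneg {p : ℝ} (hp : 0 < p) (q : ℝ) :
    ∀ w ∈ Ioo (0 : ℝ) 1, 0 ≤ betaDensity p q w := fun _ hw =>
  div_nonneg (mul_nonneg (Real.rpow_nonneg hw.1.le _)
    (Real.rpow_nonneg (sub_nonneg.2 hw.2.le) _)) (Real.Gamma_pos_of_pos hp).le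

lemma integrableOn_betaDensity {p q : ℝ} (hp : 0 < p) (hq : -1 < q) :
    IntegrableOn (betaDensity p q) (Ioo 0 1) := by
  have := (integrableOn_and_integral_beta (p := q + 1) (q := p) (by linarith) hp).1
  simp only [add_sub_cancel_right] at this
  exact this.div_const _

lemma isUnitKernel_betaKernel {p q : ℝ} (hp : 0 < p) (hq : -1 < q) :
    IsUnitKernel (betaKernel p q) :=
  isUnitKernel_unitDensity (integrableOn_betaDensity hp hq)

lemma mom_betaKernel {p q s : ℝ} (hp : 0 < p) (hqs : -1 < q + s) :
    mom (betaKernel p q) s = Real.Gamma (q + s + 1) / Real.Gamma (q + s + 1 + p) := by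
  rw [mom, betaKernel, integral_unitDensity (measurable_betaDensity p q) (betaDensity_nonneg hp q)]
  have h := (integrableOn_and_integral_beta (p := q + s + 1) (q := p) (by linarith) hp).2
  have hG := (Real.Gamma_pos_of_pos hp).ne'
  rw [mul_div_right_comm, ← div_eq_iff hG, ← integral_div] at h
  rw [← h]
  refine setIntegral_congr_fun measurableSet_Ioo fun w hw => ?_
  simp only [betaDensity, add_sub_cancel_right]
  rw [Real.rpow_add hw.1]
  ring

/-! ### The Marchaud kernel -/

lemma one_sub_rpow_le {m w : ℝ} (hw : w ∈ Ioo (0 : ℝ) 1) : 1 - w ^ m ≤ max 1 m * (1 - w) := by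
  rcases le_total m 1 with h | h
  · rw [max_eq_left h, one_mul]
    have := Real.rpow_le_rpow_of_exponent_ge hw.1 hw.2.le h
    rw [Real.rpow_one] at this
    linarith
  · rw [max_eq_right h]
    have := one_add_mul_self_le_rpow_one_add (s := w - 1) (by linarith [hw.1]) h
    rw [add_sub_cancel] at this
    linarith

/-- The Marchaud integral `∫₀¹ (1 - w ^ m) / (1 - w) ^ (r + 1) dw` of a power function. -/
def marchaud (r m : ℝ) : ℝ := ∫ w in Ioo (0 : ℝ) 1, (1 - w ^ m) * (1 - w) ^ (-r - 1)

lemma integrableOn_one_sub_rpow {r : ℝ} (hr : -1 < r) :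
    IntegrableOn (fun w : ℝ => (1 - w) ^ r) (Ioo 0 1) := by
  have := (integrableOn_and_integral_beta (p := 1) (q := r + 1) one_pos (by linarith)).1
  simpa using this

lemma integral_one_sub_rpow {r : ℝ} (hr : -1 < r) :
    ∫ w in Ioo (0 : ℝ) 1, (1 - w) ^ r = 1 / (r + 1) := by
  have := (integrableOn_and_integral_beta (p := 1) (q := r + 1) one_pos (by linarith)).2
  simp only [sub_self, Real.rpow_zero, one_mul, add_sub_cancel_right, Real.Gamma_one] at this
  rw [this, add_comm 1, Real.Gamma_add_one (by linarith : r + 1 ≠ 0)]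
  have := (Real.Gamma_pos_of_pos (by linarith : 0 < r + 1)).ne'
  field_simp

lemma integrableOn_marchaud {r m : ℝ} (hr : r < 1) (hm : 0 ≤ m) :
    IntegrableOn (fun w : ℝ => (1 - w ^ m) * (1 - w) ^ (-r - 1)) (Ioo 0 1) := by
  refine ((integrableOn_one_sub_rpow (r := -r) (by linarith)).const_mul (max 1 m)).mono'
    (by fun_prop) ?_
  filter_upwards [ae_restrict_mem measurableSet_Ioo] with w hw
  have hw' : 0 < 1 - w := by linarith [hw.2]
  have h0 : 0 ≤ 1 - w ^ m := sub_nonneg.2 (rpow_le_one_of_mem_Ioo hw hm)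
  rw [Real.norm_of_nonneg (mul_nonneg h0 (Real.rpow_nonneg hw'.le _)), Real.rpow_sub_one hw'.ne']
  calc (1 - w ^ m) * ((1 - w) ^ (-r) / (1 - w))
      ≤ (max 1 m * (1 - w)) * ((1 - w) ^ (-r) / (1 - w)) :=
        mul_le_mul_of_nonneg_right (one_sub_rpow_le hw) (by positivity)
    _ = max 1 m * (1 - w) ^ (-r) := by field_simp

/-- Integration by parts turns the Marchaud integral of a power into a beta integral. -/
lemma marchaud_eq {r m : ℝ} (hr : r < 1) (hm : 0 < m) :
    r * marchaud r m =
      Real.Gamma (1 - r) * (Real.Gamma (m + 1) / Real.Gamma (m + 1 - r)) - 1 := by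
  have hb := integrableOn_and_integral_beta (p := m) (q := 1 - r) hm (by linarith)
  have hq : 1 - r - 1 = -r := by ring
  rw [hq] at hb
  have hm1 := integrableOn_marchaud hr hm.le
  set H : ℝ → ℝ := fun w => (1 - w ^ m) * (1 - w) ^ (-r) with hH
  set H' : ℝ → ℝ := fun w => r * ((1 - w ^ m) * (1 - w) ^ (-r - 1)) -
    m * (w ^ (m - 1) * (1 - w) ^ (-r)) with hH'
  have hder : ∀ w ∈ Ioo (0 : ℝ) 1, HasDerivAt H (H' w) w := by
    intro w hw
    have hw' : 0 < 1 - w := by linarith [hw.2]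
    have h1 : HasDerivAt (fun w : ℝ => 1 - w ^ m) (-(m * w ^ (m - 1))) w :=
      (Real.hasDerivAt_rpow_const (Or.inl hw.1.ne')).const_sub 1
    have h2 : HasDerivAt (fun w : ℝ => (1 - w) ^ (-r)) (-1 * (-r) * (1 - w) ^ (-r - 1)) w :=
      ((hasDerivAt_id w).const_sub 1).rpow_const (Or.inl hw'.ne')
    refine (h1.mul h2).congr_deriv ?_
    simp only [hH']
    ring
  have hint : IntegrableOn H' (Ioo 0 1) := (hm1.const_mul r).sub (hb.1.const_mul m)
  have hcont : ContinuousOn H (Icc 0 1) := by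
    intro w hw
    rcases lt_or_eq_of_le hw.2 with h1 | rfl
    · refine ContinuousAt.continuousWithinAt ?_
      refine ContinuousAt.mul (continuousAt_const.sub (Real.continuousAt_rpow_const _ _ (Or.inr hm.le)))
        ((continuousAt_const.sub continuousAt_id).rpow_const (Or.inl ?_))
      exact (sub_pos.2 h1).ne'
    · have hH1 : H 1 = 0 := by simp [hH]
      rw [ContinuousWithinAt, hH1]
      -- near `1` the function is at most a multiple of `(1 - w) ^ (1 - r)`
      have hlim : Filter.Tendsto (fun w : ℝ => max 1 m * (1 - w) ^ (1 - r)) (𝓝[Icc 0 1] 1)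
          (𝓝 0) := by
        have : ContinuousAt (fun w : ℝ => max 1 m * (1 - w) ^ (1 - r)) 1 :=
          continuousAt_const.mul ((continuousAt_const.sub continuousAt_id).rpow_const
            (Or.inr (by linarith)))
        have h2 := this.continuousWithinAt (s := Icc 0 1)
        rw [ContinuousWithinAt] at h2
        simpa [Real.zero_rpow (by linarith : 1 - r ≠ 0)] using h2
      refine squeeze_zero_norm' ?_ hlim
      filter_upwards [self_mem_nhdsWithin, mem_nhdsWithin_of_mem_nhds (Ioi_mem_nhds one_pos)]
        with w hw hw0
      rcases lt_or_eq_of_le hw.2 with h1 | rfl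
      · have hw' : 0 < 1 - w := by linarith
        have hmem : w ∈ Ioo (0 : ℝ) 1 := ⟨hw0, h1⟩
        rw [Real.norm_of_nonneg (mul_nonneg
          (sub_nonneg.2 (rpow_le_one_of_mem_Ioo hmem hm.le)) (Real.rpow_nonneg hw'.le _))]
        calc (1 - w ^ m) * (1 - w) ^ (-r) ≤ (max 1 m * (1 - w)) * (1 - w) ^ (-r) :=
              mul_le_mul_of_nonneg_right (one_sub_rpow_le hmem) (Real.rpow_nonneg hw'.le _)
          _ = max 1 m * (1 - w) ^ (1 - r) := by
              rw [sub_eq_add_neg 1 r, Real.rpow_add hw', Real.rpow_one, mul_assoc]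
      · rw [hH1]
        simp [Real.zero_rpow (by linarith : 1 - r ≠ 0)]
  have hftc := intervalIntegral.integral_eq_sub_of_hasDerivAt_of_le zero_le_one hcont hder
    ((intervalIntegrable_iff_integrableOn_Ioo_of_le zero_le_one).2 hint)
  rw [intervalIntegral.integral_of_le zero_le_one, integral_Ioc_eq_integral_Ioo,
    integral_sub (hm1.const_mul r) (hb.1.const_mul m), integral_const_mul, integral_const_mul,
    hb.2] at hftc
  have hH0 : H 1 - H 0 = -1 := by simp [hH, Real.zero_rpow hm.ne']
  rw [hH0] at hftc
  rw [marchaud, Real.Gamma_add_one hm.ne', show m + 1 - r = m + (1 - r) by ring]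
  linear_combination hftc

/-- The density of `marchaudKernel a a'`. -/
def marchaudDensity (a a' w : ℝ) : ℝ := (w ^ a' - w ^ a) * (1 - w) ^ (-a' - 1)

/-- The measure with density `(w ^ a' - w ^ a) / (1 - w) ^ (a' + 1)` on the unit interval: up to
sign and scaling, the remainder `∫₀ˣ (x ^ (a'-a) - u ^ (a'-a)) g(u) / (x - u) ^ (a'+1) du` in the
Marchaud form of the fractional derivative of order `a'` of `u ^ (a'-a) g(u)`, for functions
`g(u)` that carry a factor `u ^ a`. -/
def marchaudKernel (a a' : ℝ) : Measure ℝ := unitDensity (marchaudDensity a a')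

lemma measurable_marchaudDensity (a a' : ℝ) : Measurable (marchaudDensity a a') := by
  unfold marchaudDensity
  fun_prop

lemma marchaudDensity_nonneg {a a' : ℝ} (h : a' ≤ a) :
    ∀ w ∈ Ioo (0 : ℝ) 1, 0 ≤ marchaudDensity a a' w := fun _ hw =>
  mul_nonneg (sub_nonneg.2 (Real.rpow_le_rpow_of_exponent_ge hw.1 hw.2.le h))
    (Real.rpow_nonneg (sub_nonneg.2 hw.2.le) _)

lemma isUnitKernel_marchaudKernel {a a' : ℝ} (h0 : 0 < a') (h1 : a' < 1) (h : a' ≤ a) :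
    IsUnitKernel (marchaudKernel a a') := by
  refine isUnitKernel_unitDensity ?_
  refine ((integrableOn_marchaud (m := a) h1 (h0.le.trans h)).sub
    (integrableOn_marchaud (m := a') h1 h0.le)).congr_fun (fun w _ => ?_) measurableSet_Ioo
  simp only [Pi.sub_apply, marchaudDensity]
  ring

lemma mom_marchaudKernel_eq {a a' s : ℝ} (h0 : 0 < a') (h1 : a' < 1) (h : a' ≤ a) (hs : 0 ≤ s) :
    mom (marchaudKernel a a') s = marchaud a' (s + a) - marchaud a' (s + a') := by
  rw [mom, marchaudKernel, integral_unitDensity (measurable_marchaudDensity a a')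
    (marchaudDensity_nonneg h), marchaud, marchaud,
    ← integral_sub (integrableOn_marchaud h1 (by linarith)) (integrableOn_marchaud h1 (by linarith))]
  refine setIntegral_congr_fun measurableSet_Ioo fun w hw => ?_
  simp only [marchaudDensity]
  rw [Real.rpow_add hw.1, Real.rpow_add hw.1]
  ring

/-- The one-variable identity that makes `derivOp` the derivative of the Riemann–Liouville
potential. The first measure on the right is the kernel of the potential of `u^(a'-a) I^a F`;
convolution with `betaKernel 1 0` is integration from `0`, so the other two are the primitives of
the two terms of the Marchaud form of the derivative. All kernels have explicit moments, and the
identity amounts to one between Gamma quotients. -/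
lemma betaKernel_one_mconv_eq {a a' : ℝ} (h0 : 0 < a') (h1 : a' < 1) (h : a' < a) :
    (betaKernel 1 0).mconv (betaKernel (a - a') 0) =
      (betaKernel (1 - a') a').mconv (betaKernel a 0) +
        (a' / Real.Gamma (1 - a')).toNNReal •
          (betaKernel 1 0).mconv ((marchaudKernel a a').mconv (betaKernel a 0)) := by
  have ha : 0 < a := h0.trans h
  have i1 := isUnitKernel_betaKernel (p := 1) (q := 0) one_pos (by norm_num)
  have i2 := isUnitKernel_betaKernel (p := a - a') (q := 0) (sub_pos.2 h) (by norm_num)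
  have i3 := isUnitKernel_betaKernel (p := 1 - a') (q := a') (sub_pos.2 h1) (by linarith)
  have i4 := isUnitKernel_betaKernel (p := a) (q := 0) ha (by norm_num)
  have i5 := isUnitKernel_marchaudKernel h0 h1 h.le
  have hG : 0 < Real.Gamma (1 - a') := Real.Gamma_pos_of_pos (by linarith)
  have i6 := IsUnitKernel.smul
    ((betaKernel 1 0).mconv ((marchaudKernel a a').mconv (betaKernel a 0)))
    (a' / Real.Gamma (1 - a')).toNNReal
  refine eq_of_forall_mom_eq _ _ fun k => ?_
  have hk : (0 : ℝ) ≤ k := k.cast_nonneg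
  have hadd : ∀ (m n : Measure ℝ) [IsUnitKernel m] [IsUnitKernel n],
      mom (m + n) k = mom m k + mom n k := fun m n _ _ =>
    integral_add_measure (integrable_rpow_of_isUnitKernel m hk)
      (integrable_rpow_of_isUnitKernel n hk)
  have hsmul : ∀ (c : NNReal) (m : Measure ℝ), mom (c • m) k = c * mom m k := fun c m => by
    rw [mom, integral_smul_nnreal_measure]; rfl
  rw [hadd, hsmul, mom_mconv _ _ hk, mom_mconv _ _ hk, mom_mconv _ _ hk, mom_mconv _ _ hk,
    mom_betaKernel one_pos (by linarith), mom_betaKernel (sub_pos.2 h) (by linarith),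
    mom_betaKernel (sub_pos.2 h1) (by linarith), mom_betaKernel ha (by linarith),
    mom_marchaudKernel_eq h0 h1 h.le hk, Real.coe_toNNReal _ (by positivity)]
  have hA := marchaud_eq h1 (m := k + a) (by linarith)
  have hB := marchaud_eq h1 (m := k + a') (by linarith)
  have e1 : (0 : ℝ) + k + 1 + 1 = (k + 1) + 1 := by ring
  have e2 : (0 : ℝ) + k + 1 + (a - a') = k + a + 1 - a' := by ring
  have e3 : a' + k + 1 + (1 - a') = (k + 1 : ℝ) + 1 := by ring
  have e4 : (k : ℝ) + a' + 1 - a' = k + 1 := by ring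
  have e5 : a' + (k : ℝ) + 1 = k + a' + 1 := by ring
  have e6 : (0 : ℝ) + k + 1 + a = k + a + 1 := by ring
  have e7 : (0 : ℝ) + k + 1 = k + 1 := by ring
  rw [e1, e2, e3, e5, e6, e7, Real.Gamma_add_one (s := (k : ℝ) + 1) (by positivity)]
  rw [e4] at hB
  have p1 : Real.Gamma ((k : ℝ) + 1) ≠ 0 := (Real.Gamma_pos_of_pos (by positivity)).ne'
  have p2 : Real.Gamma ((k : ℝ) + a + 1) ≠ 0 := (Real.Gamma_pos_of_pos (by positivity)).ne'
  have p3 : Real.Gamma ((k : ℝ) + a + 1 - a') ≠ 0 := (Real.Gamma_pos_of_pos (by linarith)).ne'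
  have hAB : a' * (marchaud a' (k + a) - marchaud a' (k + a')) = Real.Gamma (1 - a') *
      (Real.Gamma (k + a + 1) / Real.Gamma (k + a + 1 - a') -
        Real.Gamma (k + a' + 1) / Real.Gamma (k + 1)) := by
    linear_combination hA - hB
  rw [mul_comm, ← eq_div_iff h0.ne'] at hAB
  rw [hAB]
  field_simp
  ring

/-- Fractional integrals commute, in the form needed for weighted kernels: both sides have the
kernel of `I^(a+e)` with respect to functions that carry a factor `x ^ e`. -/
lemma betaKernel_mconv_swap {a e : ℝ} (ha : 0 < a) (he : 0 < e) :
    (betaKernel a e).mconv (betaKernel e 0) = (betaKernel e a).mconv (betaKernel a 0) := by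
  have i1 := isUnitKernel_betaKernel (p := a) (q := e) ha (by linarith)
  have i2 := isUnitKernel_betaKernel (p := e) (q := 0) he (by norm_num)
  have i3 := isUnitKernel_betaKernel (p := e) (q := a) he (by linarith)
  have i4 := isUnitKernel_betaKernel (p := a) (q := 0) ha (by norm_num)
  refine eq_of_forall_mom_eq _ _ fun k => ?_
  have hk : (0 : ℝ) ≤ k := k.cast_nonneg
  rw [mom_mconv _ _ hk, mom_mconv _ _ hk, mom_betaKernel ha (by linarith),
    mom_betaKernel he (by linarith), mom_betaKernel he (by linarith),
    mom_betaKernel ha (by linarith)]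
  have p1 : Real.Gamma (0 + (k : ℝ) + 1 + e) ≠ 0 := (Real.Gamma_pos_of_pos (by positivity)).ne'
  have p2 : Real.Gamma (0 + (k : ℝ) + 1 + a) ≠ 0 := (Real.Gamma_pos_of_pos (by positivity)).ne'
  have p3 : Real.Gamma (0 + (k : ℝ) + 1 + a + e) ≠ 0 :=
    (Real.Gamma_pos_of_pos (by positivity)).ne'
  rw [show e + (k : ℝ) + 1 = 0 + k + 1 + e by ring, show a + (k : ℝ) + 1 = 0 + k + 1 + a by ring,
    show 0 + (k : ℝ) + 1 + e + a = 0 + k + 1 + a + e by ring]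
  field_simp

/-! ### Averages over dilations -/

/-- A bounded Borel function of two variables. -/
structure IsBddMeas (F : ℝ → ℝ → ℝ) : Prop where
  meas : Measurable (Function.uncurry F)
  bdd : ∃ M, ∀ x y, |F x y| ≤ M

/-- The average `∫∫ F(x w, y z) dn(z) dm(w)` of a function over dilations in each variable. -/
def dil₂ (m n : Measure ℝ) (F : ℝ → ℝ → ℝ) (x y : ℝ) : ℝ :=
  ∫ w, ∫ z, F (x * w) (y * z) ∂n ∂m

lemma integral_bdd_meas {φ : ℝ → ℝ → ℝ} (hφ : IsBddMeas φ) (m : Measure ℝ) [IsFiniteMeasure m] :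
    Measurable (fun x => ∫ w, φ x w ∂m) ∧ ∃ M, ∀ x, |∫ w, φ x w ∂m| ≤ M := by
  obtain ⟨M, hM⟩ := hφ.bdd
  refine ⟨(hφ.meas.stronglyMeasurable.integral_prod_right).measurable, M * m.real univ, fun x => ?_⟩
  rw [← Real.norm_eq_abs]
  exact norm_integral_le_of_norm_le_const (Filter.Eventually.of_forall fun w => hM x w)

namespace IsBddMeas

variable {F G : ℝ → ℝ → ℝ}

lemma comp (hF : IsBddMeas F) {f g : ℝ × ℝ → ℝ} (hf : Measurable f) (hg : Measurable g) :
    IsBddMeas fun x y => F (f (x, y)) (g (x, y)) :=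
  ⟨hF.meas.comp (hf.prodMk hg), hF.bdd.imp fun _ h _ _ => h _ _⟩

lemma integrable_prod (hF : IsBddMeas F) (m n : Measure ℝ) [IsFiniteMeasure m]
    [IsFiniteMeasure n] : Integrable (Function.uncurry F) (m.prod n) := by
  obtain ⟨M, hM⟩ := hF.bdd
  exact Integrable.of_bound hF.meas.aestronglyMeasurable M
    (Filter.Eventually.of_forall fun z => hM z.1 z.2)

lemma integrable_right (hF : IsBddMeas F) (m : Measure ℝ) [IsFiniteMeasure m] (x : ℝ) :
    Integrable (F x) m := by
  obtain ⟨M, hM⟩ := hF.bdd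
  exact Integrable.of_bound (hF.meas.comp measurable_prodMk_left).aestronglyMeasurable M
    (Filter.Eventually.of_forall fun z => hM x z)

lemma integral_right (hF : IsBddMeas F) (m n : Measure ℝ) [IsFiniteMeasure m]
    [IsFiniteMeasure n] : Integrable (fun x => ∫ y, F x y ∂n) m := by
  obtain ⟨h1, M, h2⟩ := integral_bdd_meas hF n
  exact Integrable.of_bound h1.aestronglyMeasurable M (Filter.Eventually.of_forall h2)

lemma integral_swap (hF : IsBddMeas F) (m n : Measure ℝ) [IsFiniteMeasure m]
    [IsFiniteMeasure n] : ∫ x, ∫ y, F x y ∂n ∂m = ∫ y, ∫ x, F x y ∂m ∂n :=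
  integral_integral_swap (hF.integrable_prod m n)

lemma add (hF : IsBddMeas F) (hG : IsBddMeas G) : IsBddMeas fun x y => F x y + G x y := by
  obtain ⟨M, hM⟩ := hF.bdd
  obtain ⟨N, hN⟩ := hG.bdd
  exact ⟨hF.meas.add hG.meas, M + N, fun x y =>
    (abs_add_le _ _).trans (add_le_add (hM x y) (hN x y))⟩

lemma const_mul (hF : IsBddMeas F) (c : ℝ) : IsBddMeas fun x y => c * F x y := by
  obtain ⟨M, hM⟩ := hF.bdd
  refine ⟨hF.meas.const_mul c, |c| * M, fun x y => ?_⟩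
  rw [abs_mul]
  exact mul_le_mul_of_nonneg_left (hM x y) (abs_nonneg c)

lemma scale (hF : IsBddMeas F) (x y : ℝ) : IsBddMeas fun w z => F (x * w) (y * z) :=
  hF.comp (f := fun p => x * p.1) (g := fun p => y * p.2) (by fun_prop) (by fun_prop)

lemma integral₂ {Φ : ℝ → ℝ → ℝ → ℝ} (hm : Measurable fun p : ℝ × ℝ × ℝ => Φ p.1 p.2.1 p.2.2)
    {M : ℝ} (hM : ∀ x y z, |Φ x y z| ≤ M) (n : Measure ℝ) [IsFiniteMeasure n] :
    IsBddMeas fun x y => ∫ z, Φ x y z ∂n := by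
  refine ⟨?_, M * n.real univ, fun x y => ?_⟩
  · have h : Measurable (Function.uncurry fun (p : ℝ × ℝ) (z : ℝ) => Φ p.1 p.2 z) :=
      hm.comp (f := fun q : (ℝ × ℝ) × ℝ => (q.1.1, q.1.2, q.2)) (by fun_prop)
    exact h.stronglyMeasurable.integral_prod_right.measurable
  · rw [← Real.norm_eq_abs]
    exact norm_integral_le_of_norm_le_const (Filter.Eventually.of_forall fun w => hM x y w)

lemma dil₂ (hF : IsBddMeas F) (m n : Measure ℝ) [IsFiniteMeasure m] [IsFiniteMeasure n] :
    IsBddMeas (dil₂ m n F) := by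
  obtain ⟨M, hM⟩ := hF.bdd
  have h : ∀ x y, _root_.dil₂ m n F x y = ∫ p, F (x * p.1) (y * p.2) ∂(m.prod n) := fun x y =>
    (integral_prod _ ((hF.scale x y).integrable_prod m n)).symm
  refine ⟨?_, M * (m.prod n).real univ, fun x y => ?_⟩
  · have h1 : Measurable (Function.uncurry fun (q p : ℝ × ℝ) => F (q.1 * p.1) (q.2 * p.2)) :=
      hF.meas.comp (f := fun r : (ℝ × ℝ) × (ℝ × ℝ) => (r.1.1 * r.2.1, r.1.2 * r.2.2)) (by fun_prop)
    have e : Function.uncurry (_root_.dil₂ m n F) =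
        fun q : ℝ × ℝ => ∫ p, F (q.1 * p.1) (q.2 * p.2) ∂(m.prod n) := funext fun q => h q.1 q.2
    rw [e]
    exact (h1.stronglyMeasurable.integral_prod_right (ν := m.prod n)).measurable
  · rw [h, ← Real.norm_eq_abs]
    exact norm_integral_le_of_norm_le_const (Filter.Eventually.of_forall fun w => hM _ _)

end IsBddMeas

section dil₂

variable {F G : ℝ → ℝ → ℝ} (m m' n n' : Measure ℝ)

lemma dil₂_swap [IsFiniteMeasure m] [IsFiniteMeasure n] (hF : IsBddMeas F) (x y : ℝ) :
    dil₂ m n F x y = ∫ z, ∫ w, F (x * w) (y * z) ∂m ∂n :=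
  (hF.scale x y).integral_swap m n

/-- Averages over dilations compose by multiplicative convolution. -/
lemma dil₂_dil₂ [IsFiniteMeasure m] [IsFiniteMeasure m'] [IsFiniteMeasure n] [IsFiniteMeasure n']
    (hF : IsBddMeas F) (x y : ℝ) :
    dil₂ m n (dil₂ m' n' F) x y = dil₂ (m.mconv m') (n.mconv n') F x y := by
  obtain ⟨M, hM⟩ := hF.bdd
  have hx : IsBddMeas fun w z => F (x * w) (y * z) := hF.scale x y
  simp only [dil₂]
  rw [integral_mconv (hx.integral_right _ _)]
  refine integral_congr_ae (Filter.Eventually.of_forall fun w => ?_)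
  have hsw : IsBddMeas fun z w' => ∫ z', F (x * w * w') (y * z * z') ∂n' :=
    IsBddMeas.integral₂ (Φ := fun z w' z' => F (x * w * w') (y * z * z'))
      (hF.meas.comp (f := fun p : ℝ × ℝ × ℝ => (x * w * p.2.1, y * p.1 * p.2.2)) (by fun_prop))
      (fun _ _ _ => hM _ _) n'
  dsimp only
  rw [hsw.integral_swap]
  refine integral_congr_ae (Filter.Eventually.of_forall fun w' => ?_)
  dsimp only
  rw [integral_mconv (hx.integrable_right _ _)]
  simp only [mul_assoc]

lemma dil₂_add [IsFiniteMeasure m] [IsFiniteMeasure n] (hF : IsBddMeas F) (hG : IsBddMeas G)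
    (x y : ℝ) : dil₂ m n (fun x y => F x y + G x y) x y = dil₂ m n F x y + dil₂ m n G x y := by
  have h1 := hF.scale x y
  have h2 := hG.scale x y
  simp only [dil₂]
  rw [← integral_add (h1.integral_right m n) (h2.integral_right m n)]
  refine integral_congr_ae (Filter.Eventually.of_forall fun w => ?_)
  exact integral_add (h1.integrable_right n w) (h2.integrable_right n w)

lemma dil₂_const_mul (c x y : ℝ) :
    dil₂ m n (fun x y => c * F x y) x y = c * dil₂ m n F x y := by
  simp only [dil₂, integral_const_mul]

lemma dil₂_add_left [IsFiniteMeasure m] [IsFiniteMeasure m'] [IsFiniteMeasure n]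
    (hF : IsBddMeas F) (x y : ℝ) :
    dil₂ (m + m') n F x y = dil₂ m n F x y + dil₂ m' n F x y :=
  integral_add_measure ((hF.scale x y).integral_right m n) ((hF.scale x y).integral_right m' n)

lemma dil₂_smul_left (c : NNReal) (x y : ℝ) :
    dil₂ (c • m) n F x y = c * dil₂ m n F x y := by
  rw [dil₂, integral_smul_nnreal_measure]
  rfl

lemma dil₂_add_right [IsFiniteMeasure m] [IsFiniteMeasure n] [IsFiniteMeasure n']
    (hF : IsBddMeas F) (x y : ℝ) :
    dil₂ m (n + n') F x y = dil₂ m n F x y + dil₂ m n' F x y := by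
  have h := hF.scale x y
  simp only [dil₂]
  rw [← integral_add (h.integral_right m n) (h.integral_right m n')]
  refine integral_congr_ae (Filter.Eventually.of_forall fun w => ?_)
  exact integral_add_measure (h.integrable_right n w) (h.integrable_right n' w)

lemma dil₂_smul_right (c : NNReal) (x y : ℝ) :
    dil₂ m (c • n) F x y = c * dil₂ m n F x y := by
  simp only [dil₂]
  rw [← integral_const_mul]
  refine integral_congr_ae (Filter.Eventually.of_forall fun w => ?_)
  dsimp only
  rw [integral_smul_nnreal_measure]
  rfl

/-- A power bound on `F` turns into the same power bound on its average, with the moments of the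
measures as factors. -/
lemma abs_dil₂_le [IsUnitKernel m] [IsUnitKernel n] {T C g g' x y : ℝ} (hg : 0 ≤ g) (hg' : 0 ≤ g')
    (hF : ∀ x ∈ Ioc 0 T, ∀ y ∈ Ioc 0 T, |F x y| ≤ C * x ^ g * y ^ g')
    (hx : x ∈ Ioc 0 T) (hy : y ∈ Ioc 0 T) :
    |dil₂ m n F x y| ≤ C * x ^ g * y ^ g' * (mom m g * mom n g') := by
  have hmem : ∀ x ∈ Ioc 0 T, ∀ w ∈ Ioo (0 : ℝ) 1, x * w ∈ Ioc 0 T := fun x hx w hw =>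
    ⟨mul_pos hx.1 hw.1, (mul_le_of_le_one_right hx.1.le hw.2.le).trans hx.2⟩
  have h1 : ∀ w ∈ Ioo (0 : ℝ) 1, |∫ z, F (x * w) (y * z) ∂n| ≤
      C * x ^ g * y ^ g' * mom n g' * w ^ g := by
    intro w hw
    rw [← Real.norm_eq_abs, mom, mul_right_comm, ← integral_const_mul]
    refine norm_integral_le_of_norm_le ((integrable_rpow_of_isUnitKernel n hg').const_mul _) ?_
    filter_upwards [IsUnitKernel.ae_mem (m := n)] with z hz
    refine (hF _ (hmem x hx w hw) _ (hmem y hy z hz)).trans_eq ?_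
    rw [Real.mul_rpow hx.1.le hw.1.le, Real.mul_rpow hy.1.le hz.1.le]
    ring
  rw [dil₂, ← Real.norm_eq_abs, mul_comm (mom m g), ← mul_assoc]
  nth_rewrite 2 [mom]
  rw [← integral_const_mul]
  refine norm_integral_le_of_norm_le ((integrable_rpow_of_isUnitKernel m hg).const_mul _) ?_
  filter_upwards [IsUnitKernel.ae_mem (m := m)] with w hw using h1 w hw

end dil₂

/-- The tensor product of the signed operators `m - c m'` and `n - d n'`, where a measure stands
for averaging over dilations. -/
def sdil (c d : ℝ) (m m' n n' : Measure ℝ) (F : ℝ → ℝ → ℝ) (x y : ℝ) : ℝ :=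
  dil₂ m n F x y + (-c * dil₂ m' n F x y + (-d * dil₂ m n' F x y + c * d * dil₂ m' n' F x y))

section sdil

variable {F : ℝ → ℝ → ℝ} (c d : ℝ) (m m' n n' p q : Measure ℝ)
  [IsFiniteMeasure m] [IsFiniteMeasure m'] [IsFiniteMeasure n] [IsFiniteMeasure n']
  [IsFiniteMeasure p] [IsFiniteMeasure q]

lemma IsBddMeas.sdil (hF : IsBddMeas F) : IsBddMeas (sdil c d m m' n n' F) :=
  (hF.dil₂ m n).add (((hF.dil₂ m' n).const_mul _).add
    (((hF.dil₂ m n').const_mul _).add ((hF.dil₂ m' n').const_mul _)))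

lemma dil₂_sdil (hF : IsBddMeas F) (x y : ℝ) :
    dil₂ p q (sdil c d m m' n n' F) x y =
      sdil c d (p.mconv m) (p.mconv m') (q.mconv n) (q.mconv n') F x y := by
  have h1 := hF.dil₂ m n
  have h2 := (hF.dil₂ m' n).const_mul (-c)
  have h3 := (hF.dil₂ m n').const_mul (-d)
  have h4 := (hF.dil₂ m' n').const_mul (c * d)
  simp only [sdil, ← dil₂_dil₂ _ _ _ _ hF]
  rw [← dil₂_const_mul, ← dil₂_const_mul, ← dil₂_const_mul, ← dil₂_add _ _ h3 h4,
    ← dil₂_add _ _ h2 (h3.add h4), ← dil₂_add _ _ h1 (h2.add (h3.add h4))]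
  rfl

lemma sdil_mconv (hF : IsBddMeas F) (x y : ℝ) :
    sdil c d (m.mconv p) (m'.mconv p) (n.mconv q) (n'.mconv q) F x y =
      sdil c d m m' n n' (dil₂ p q F) x y := by
  simp only [sdil, dil₂_dil₂ _ _ _ _ hF]

/-- Cancellation of signs: if `m = m₀ + c m'` and `n = n₀ + d n'` as positive measures, then
`(m - c m') ⊗ (n - d n') = m₀ ⊗ n₀`. -/
lemma sdil_eq_dil₂ (hF : IsBddMeas F) (c d : NNReal) {m₀ n₀ : Measure ℝ} [IsFiniteMeasure m₀]
    [IsFiniteMeasure n₀] (hm : m = m₀ + c • m') (hn : n = n₀ + d • n') (x y : ℝ) :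
    sdil c d m m' n n' F x y = dil₂ m₀ n₀ F x y := by
  subst hm hn
  simp only [sdil]
  rw [dil₂_add_left _ _ _ hF, dil₂_add_left _ _ _ hF, dil₂_add_right _ _ _ hF,
    dil₂_add_right _ _ _ hF, dil₂_add_right _ _ _ hF]
  simp only [dil₂_smul_left, dil₂_smul_right]
  ring

lemma abs_sdil_le {c d : ℝ} (hc : 0 ≤ c) (hd : 0 ≤ d) (m m' n n' : Measure ℝ) [IsUnitKernel m]
    [IsUnitKernel m'] [IsUnitKernel n] [IsUnitKernel n'] {T C g g' x y : ℝ} (hg : 0 ≤ g)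
    (hg' : 0 ≤ g') (hF : ∀ x ∈ Ioc 0 T, ∀ y ∈ Ioc 0 T, |F x y| ≤ C * x ^ g * y ^ g')
    (hx : x ∈ Ioc 0 T) (hy : y ∈ Ioc 0 T) :
    |sdil c d m m' n n' F x y| ≤
      C * x ^ g * y ^ g' * ((mom m g + c * mom m' g) * (mom n g' + d * mom n' g')) := by
  have h1 := abs_dil₂_le m n hg hg' hF hx hy
  have h2 := mul_le_mul_of_nonneg_left (abs_dil₂_le m' n hg hg' hF hx hy) hc
  have h3 := mul_le_mul_of_nonneg_left (abs_dil₂_le m n' hg hg' hF hx hy) hd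
  have h4 := mul_le_mul_of_nonneg_left (abs_dil₂_le m' n' hg hg' hF hx hy) (mul_nonneg hc hd)
  have e2 : |-c * dil₂ m' n F x y| = c * |dil₂ m' n F x y| := by
    rw [abs_mul, abs_neg, abs_of_nonneg hc]
  have e3 : |-d * dil₂ m n' F x y| = d * |dil₂ m n' F x y| := by
    rw [abs_mul, abs_neg, abs_of_nonneg hd]
  have e4 : |c * d * dil₂ m' n' F x y| = c * d * |dil₂ m' n' F x y| := by
    rw [abs_mul, abs_of_nonneg (mul_nonneg hc hd)]
  have t1 := abs_add_le (dil₂ m n F x y)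
    (-c * dil₂ m' n F x y + (-d * dil₂ m n' F x y + c * d * dil₂ m' n' F x y))
  have t2 := abs_add_le (-c * dil₂ m' n F x y)
    (-d * dil₂ m n' F x y + c * d * dil₂ m' n' F x y)
  have t3 := abs_add_le (-d * dil₂ m n' F x y) (c * d * dil₂ m' n' F x y)
  rw [sdil]
  linarith

end sdil

/-! ### Continuity of averages over dilations -/

/-- Averaging over dilations with respect to `m` turns bounded Borel functions into functions that
are continuous on `(0, ∞)`. -/
def IsContKernel (m : Measure ℝ) : Prop :=
  ∀ φ : ℝ → ℝ, Measurable φ → (∃ M, ∀ r, |φ r| ≤ M) →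
    ∀ t > 0, ContinuousAt (fun t => ∫ z, φ (t * z) ∂m) t

lemma continuousAt_integral_comp_mul {g φ : ℝ → ℝ} (hg : Continuous g) (hgc : HasCompactSupport g)
    (hφ : Measurable φ) {M : ℝ} (hM : ∀ r, |φ r| ≤ M) {t : ℝ} (ht : 0 < t) :
    ContinuousAt (fun t => ∫ z, g z * φ (t * z)) t := by
  obtain ⟨B, hB⟩ := hgc.exists_bound_of_continuous hg
  obtain ⟨R, hR⟩ := (hgc.isBounded).subset_closedBall 0
  have hM0 : 0 ≤ M := (abs_nonneg _).trans (hM 0)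
  have hB0 : 0 ≤ B := (norm_nonneg _).trans (hB 0)
  -- after a change of variables the parameter appears only in the continuous factor
  have hsub : ∀ s > 0, ∫ z, g z * φ (s * z) = s⁻¹ * ∫ r, g (r / s) * φ r := by
    intro s hs
    have := Measure.integral_comp_mul_left (fun r => g (r / s) * φ r) s
    rw [abs_of_pos (inv_pos.2 hs), smul_eq_mul] at this
    rw [← this]
    refine integral_congr_ae (Filter.Eventually.of_forall fun z => ?_)
    simp only [mul_div_cancel_left₀ z hs.ne']
  have hev : ∀ᶠ s in 𝓝 t, 0 < s ∧ s < 2 * t :=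
    Ioo_mem_nhds ht (by linarith)
  refine ContinuousAt.congr (f := fun s => s⁻¹ * ∫ r, g (r / s) * φ r) ?_
    (hev.mono fun s hs => (hsub s hs.1).symm)
  refine (continuousAt_inv₀ ht.ne').mul ?_
  refine continuousAt_of_dominated
    (bound := (Icc (-(2 * t * R)) (2 * t * R)).indicator fun _ => B * M) ?_ ?_ ?_ ?_
  · exact Filter.Eventually.of_forall fun s =>
      ((hg.measurable.comp (by fun_prop)).mul hφ).aestronglyMeasurable
  · filter_upwards [hev] with s hs
    refine Filter.Eventually.of_forall fun r => ?_
    rw [norm_mul, Real.norm_eq_abs (φ r)]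
    by_cases hr : r ∈ Icc (-(2 * t * R)) (2 * t * R)
    · rw [indicator_of_mem hr]
      exact mul_le_mul (hB _) (hM r) (abs_nonneg _) hB0
    · rw [indicator_of_notMem hr]
      have : g (r / s) = 0 := by
        by_contra hne
        have h1 := hR (subset_tsupport g hne)
        rw [mem_closedBall_zero_iff, Real.norm_eq_abs, abs_div, abs_of_pos hs.1,
          div_le_iff₀ hs.1] at h1
        have hR0 : 0 ≤ R := by
          by_contra hneg
          push Not at hneg
          have := mul_neg_of_neg_of_pos hneg hs.1
          linarith [abs_nonneg r]
        have h2 : R * s ≤ 2 * t * R := by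
          rw [mul_comm (2 * t)]
          exact mul_le_mul_of_nonneg_left hs.2.le hR0
        exact hr (abs_le.1 (h1.trans h2))
      rw [this]
      simp
  · exact (integrable_indicator_iff measurableSet_Icc).2 continuousOn_const.integrableOn_Icc
  · refine Filter.Eventually.of_forall fun r => ?_
    exact ((hg.continuousAt).comp (continuousAt_const.div continuousAt_id ht.ne')).mul
      continuousAt_const

lemma isContKernel_unitDensity {k : ℝ → ℝ} (hk : Measurable k)
    (h0 : ∀ w ∈ Ioo (0 : ℝ) 1, 0 ≤ k w) (hint : IntegrableOn k (Ioo 0 1)) :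
    IsContKernel (unitDensity k) := by
  rintro φ hφ ⟨M, hM⟩ t ht
  have hM0 : 0 ≤ M := (abs_nonneg _).trans (hM 0)
  have hK : Integrable ((Ioo 0 1).indicator k) := (integrable_indicator_iff measurableSet_Ioo).2 hint
  have heq : ∀ s, ∫ z, φ (s * z) ∂(unitDensity k) =
      ∫ z, (Ioo 0 1).indicator k z * φ (s * z) := by
    intro s
    rw [integral_unitDensity hk h0, ← integral_indicator measurableSet_Ioo]
    refine integral_congr_ae (Filter.Eventually.of_forall fun z => ?_)
    by_cases hz : z ∈ Ioo (0 : ℝ) 1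
    · simp only [indicator_of_mem hz]
    · simp only [indicator_of_notMem hz, zero_mul]
  simp only [heq]
  have hmulint : ∀ {f : ℝ → ℝ}, Integrable f → ∀ s, Integrable fun z => f z * φ (s * z) :=
    fun hf s => hf.mul_bdd (c := M) (hφ.comp (by fun_prop)).aestronglyMeasurable
      (Filter.Eventually.of_forall fun z => hM _)
  -- approximation of the density in `L¹` by compactly supported continuous functions
  refine continuousAt_of_locally_uniform_approx_of_continuousAt fun u hu => ?_
  obtain ⟨e, he, heu⟩ := Metric.mem_uniformity_dist.1 hu
  obtain ⟨g, hgc, hgd, hg, hgi⟩ := hK.exists_hasCompactSupport_integral_sub_le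
    (ε := e / (2 * (M + 1))) (by positivity)
  refine ⟨univ, Filter.univ_mem, fun s => ∫ z, g z * φ (s * z),
    continuousAt_integral_comp_mul hg hgc hφ hM ht, fun s _ => heu ?_⟩
  rw [Real.dist_eq, ← integral_sub (hmulint hK s) (hmulint hgi s)]
  calc |∫ z, ((Ioo 0 1).indicator k z * φ (s * z) - g z * φ (s * z))|
      ≤ ∫ z, ‖(Ioo 0 1).indicator k z - g z‖ * M := by
        rw [← Real.norm_eq_abs]
        refine norm_integral_le_of_norm_le ((hK.sub hgi).norm.mul_const M)
          (Filter.Eventually.of_forall fun z => ?_)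
        rw [← sub_mul, norm_mul]
        exact mul_le_mul_of_nonneg_left (hM _) (norm_nonneg _)
    _ ≤ e / (2 * (M + 1)) * M := by
        rw [integral_mul_const]
        exact mul_le_mul_of_nonneg_right hgd hM0
    _ < e := by
        rw [div_mul_eq_mul_div, div_lt_iff₀ (by positivity)]
        nlinarith

lemma IsContKernel.mconv {m n : Measure ℝ} [IsUnitKernel m] [IsFiniteMeasure n]
    (hn : IsContKernel n) : IsContKernel (m.mconv n) := by
  rintro φ hφ ⟨M, hM⟩ t ht
  have hint : ∀ (μ : Measure ℝ) [IsFiniteMeasure μ] (s : ℝ), Integrable (fun z => φ (s * z)) μ :=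
    fun μ _ s => Integrable.of_bound (hφ.comp (by fun_prop)).aestronglyMeasurable M
      (Filter.Eventually.of_forall fun z => hM _)
  have heq : ∀ s, ∫ z, φ (s * z) ∂(m.mconv n) = ∫ w, ∫ z, φ (s * w * z) ∂n ∂m := by
    intro s
    rw [integral_mconv (hint _ s)]
    simp only [mul_assoc]
  simp only [heq]
  have hb : IsBddMeas fun s z => φ (s * z) :=
    ⟨hφ.comp (by fun_prop), M, fun _ _ => hM _⟩
  obtain ⟨hm1, M', hM'⟩ := integral_bdd_meas hb n
  refine continuousAt_of_dominated (bound := fun _ => M') ?_ ?_ (integrable_const _) ?_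
  · exact Filter.Eventually.of_forall fun s => (hm1.comp (by fun_prop)).aestronglyMeasurable
  · exact Filter.Eventually.of_forall fun s => Filter.Eventually.of_forall fun w => hM' _
  · filter_upwards [IsUnitKernel.ae_mem (m := m)] with w hw
    exact ContinuousAt.comp (f := fun s => s * w)
      (hn φ hφ ⟨M, hM⟩ (t * w) (mul_pos ht hw.1)) (by fun_prop)

lemma isContKernel_betaKernel {p q : ℝ} (hp : 0 < p) (hq : -1 < q) :
    IsContKernel (betaKernel p q) :=
  isContKernel_unitDensity (measurable_betaDensity p q) (betaDensity_nonneg hp q)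
    (integrableOn_betaDensity hp hq)

section continuity

variable {F : ℝ → ℝ → ℝ} {m m' n n' : Measure ℝ} [IsFiniteMeasure n] [IsFiniteMeasure n']

lemma continuousAt_dil₂_left (hF : IsBddMeas F) (hm : IsContKernel m) (y : ℝ) {x : ℝ}
    (hx : 0 < x) : ContinuousAt (fun x => dil₂ m n F x y) x := by
  obtain ⟨h1, h2⟩ := integral_bdd_meas
    (hF.comp (f := fun p => p.1) (g := fun p => y * p.2) (by fun_prop) (by fun_prop)) n
  exact hm _ h1 h2 x hx

lemma continuousAt_dil₂_right [IsFiniteMeasure m] (hF : IsBddMeas F) (hn : IsContKernel n) (x : ℝ) {y : ℝ}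
    (hy : 0 < y) : ContinuousAt (fun y => dil₂ m n F x y) y := by
  obtain ⟨h1, h2⟩ := integral_bdd_meas
    (hF.comp (f := fun p => x * p.2) (g := fun p => p.1) (by fun_prop) (by fun_prop)) m
  simp only [dil₂_swap m n hF]
  exact hn _ h1 h2 y hy

lemma continuousAt_sdil_left (hF : IsBddMeas F) (c d : ℝ) (hm : IsContKernel m)
    (hm' : IsContKernel m') (y : ℝ) {x : ℝ} (hx : 0 < x) :
    ContinuousAt (fun x => sdil c d m m' n n' F x y) x :=
  (continuousAt_dil₂_left hF hm y hx).add
    ((continuousAt_const.mul (continuousAt_dil₂_left hF hm' y hx)).add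
      ((continuousAt_const.mul (continuousAt_dil₂_left hF hm y hx)).add
        (continuousAt_const.mul (continuousAt_dil₂_left hF hm' y hx))))

lemma continuousAt_sdil_right [IsFiniteMeasure m] [IsFiniteMeasure m'] (hF : IsBddMeas F) (c d : ℝ) (hn : IsContKernel n)
    (hn' : IsContKernel n') (x : ℝ) {y : ℝ} (hy : 0 < y) :
    ContinuousAt (fun y => sdil c d m m' n n' F x y) y :=
  (continuousAt_dil₂_right hF hn x hy).add
    ((continuousAt_const.mul (continuousAt_dil₂_right hF hn x hy)).add
      ((continuousAt_const.mul (continuousAt_dil₂_right hF hn' x hy)).add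
        (continuousAt_const.mul (continuousAt_dil₂_right hF hn' x hy))))

end continuity

/-! ### Riemann–Liouville operators as averages over dilations -/

lemma integral_sub_rpow_mul {p y : ℝ} (hp : 0 < p) (hy : 0 < y) (φ : ℝ → ℝ) :
    ∫ v in (0 : ℝ)..y, (y - v) ^ (p - 1) * φ v =
      y ^ p * (Real.Gamma p * ∫ z, φ (y * z) ∂(betaKernel p 0)) := by
  have h := intervalIntegral.integral_comp_mul_left (a := 0) (b := 1)
    (fun v => (y - v) ^ (p - 1) * φ v) hy.ne'
  rw [mul_zero, mul_one, smul_eq_mul, eq_inv_mul_iff_mul_eq₀ hy.ne'] at h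
  rw [← h, intervalIntegral.integral_of_le zero_le_one, integral_Ioc_eq_integral_Ioo, betaKernel,
    integral_unitDensity (measurable_betaDensity p 0) (betaDensity_nonneg hp 0),
    ← integral_const_mul, ← integral_const_mul, ← integral_const_mul]
  refine setIntegral_congr_fun measurableSet_Ioo fun z hz => ?_
  have h1 : y - y * z = y * (1 - z) := by ring
  have hG := (Real.Gamma_pos_of_pos hp).ne'
  simp only [betaDensity, Real.rpow_zero]
  rw [h1, Real.mul_rpow hy.le (sub_nonneg.2 hz.2.le), Real.rpow_sub_one hy.ne']
  field_simp

lemma rlIntegral_eq_dil₂ {a b x y : ℝ} (ha : 0 < a) (hb : 0 < b) (hx : 0 < x) (hy : 0 < y)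
    (F : ℝ → ℝ → ℝ) :
    rlIntegral a b F x y = x ^ a * y ^ b * dil₂ (betaKernel a 0) (betaKernel b 0) F x y := by
  have h1 : ∀ u, ∫ v in (0 : ℝ)..y, (x - u) ^ (a - 1) * (y - v) ^ (b - 1) * F u v =
      (x - u) ^ (a - 1) *
        (y ^ b * (Real.Gamma b * ∫ z, F u (y * z) ∂(betaKernel b 0))) := by
    intro u
    rw [← integral_sub_rpow_mul hb hy, ← intervalIntegral.integral_const_mul]
    simp only [mul_assoc]
  have ha' := (Real.Gamma_pos_of_pos ha).ne'
  have hb' := (Real.Gamma_pos_of_pos hb).ne'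
  simp only [rlIntegral, h1]
  rw [integral_sub_rpow_mul ha hx, integral_const_mul, integral_const_mul, dil₂]
  field_simp

lemma rlIntegral_congr {a b x y : ℝ} (hx : 0 ≤ x) (hy : 0 ≤ y) {f g : ℝ → ℝ → ℝ}
    (h : ∀ u ∈ Ioc 0 x, ∀ v ∈ Ioc 0 y, f u v = g u v) :
    rlIntegral a b f x y = rlIntegral a b g x y := by
  simp only [rlIntegral, intervalIntegral.integral_of_le hx, intervalIntegral.integral_of_le hy]
  congr 1
  refine setIntegral_congr_fun measurableSet_Ioc fun u hu => ?_
  refine setIntegral_congr_fun measurableSet_Ioc fun v hv => ?_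
  simp only [h u hu v hv]

lemma potential_kernel_eq {α β x y u v : ℝ} (hu : u ≤ x) (hv : v ≤ y) (r : ℝ) :
    r / ((x - u) ^ α * (y - v) ^ β) = (x - u) ^ (1 - α - 1) * (y - v) ^ (1 - β - 1) * r := by
  rw [show 1 - α - 1 = -α by ring, show 1 - β - 1 = -β by ring, Real.rpow_neg (sub_nonneg.2 hu),
    Real.rpow_neg (sub_nonneg.2 hv), div_eq_mul_inv, mul_inv, mul_comm]

lemma rlPotential_eq_rlIntegral {α β x y : ℝ} (hα : α < 1) (hβ : β < 1) (hx : 0 ≤ x) (hy : 0 ≤ y)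
    (g : ℝ → ℝ → ℝ) :
    rlPotential α β g x y =
      Real.Gamma (1 - α) * Real.Gamma (1 - β) * rlIntegral (1 - α) (1 - β) g x y := by
  have h1 := (Real.Gamma_pos_of_pos (sub_pos.2 hα)).ne'
  have h2 := (Real.Gamma_pos_of_pos (sub_pos.2 hβ)).ne'
  rw [rlIntegral, ← mul_assoc, mul_one_div_cancel (mul_ne_zero h1 h2), one_mul, rlPotential]
  simp only [intervalIntegral.integral_of_le hx, intervalIntegral.integral_of_le hy]
  refine setIntegral_congr_fun measurableSet_Ioc fun u hu => ?_
  refine setIntegral_congr_fun measurableSet_Ioc fun v hv => ?_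
  exact potential_kernel_eq hu.2 hv.2 _

lemma integral_betaKernel_rpow_mul {p q x : ℝ} (hp : 0 < p) (hx : 0 < x) (φ : ℝ → ℝ) :
    ∫ w, (x * w) ^ q * φ w ∂(betaKernel p 0) = x ^ q * ∫ w, φ w ∂(betaKernel p q) := by
  rw [betaKernel, betaKernel, integral_unitDensity (measurable_betaDensity p q)
    (betaDensity_nonneg hp q), integral_unitDensity (measurable_betaDensity p 0)
    (betaDensity_nonneg hp 0), ← integral_const_mul]
  refine setIntegral_congr_fun measurableSet_Ioo fun z hz => ?_
  simp only [betaDensity, Real.rpow_zero]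
  rw [Real.mul_rpow hx.le hz.1.le]
  ring

lemma dil₂_weightMul {p q r s x y : ℝ} (hp : 0 < p) (hq : 0 < q) (hx : 0 < x) (hy : 0 < y)
    (g : ℝ → ℝ → ℝ) :
    dil₂ (betaKernel p 0) (betaKernel q 0) (weightMul r s g) x y =
      x ^ r * y ^ s * dil₂ (betaKernel p r) (betaKernel q s) g x y := by
  have h : ∀ w, ∫ z, weightMul r s g (x * w) (y * z) ∂(betaKernel q 0) =
      (x * w) ^ r * (y ^ s * ∫ z, g (x * w) (y * z) ∂(betaKernel q s)) := by
    intro w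
    rw [← integral_betaKernel_rpow_mul hq hy, ← integral_const_mul]
    simp only [weightMul, mul_assoc]
  rw [dil₂]
  simp only [h]
  rw [integral_betaKernel_rpow_mul hp hx, integral_const_mul, dil₂, mul_assoc]

/-- The operator `D^{a',b'} x^(a'-a) y^(b'-b) I^{a,b}`, written as a tensor product of signed
averages over dilations. In each variable the first term is `x^(a'-a) I^(a-a')`, and the second is
the correction in the Marchaud form of the derivative that is due to the weight. -/
def derivOp (a a' b b' : ℝ) : (ℝ → ℝ → ℝ) → ℝ → ℝ → ℝ :=
  sdil (a' / Real.Gamma (1 - a')) (b' / Real.Gamma (1 - b'))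
    (betaKernel (a - a') 0) ((marchaudKernel a a').mconv (betaKernel a 0))
    (betaKernel (b - b') 0) ((marchaudKernel b b').mconv (betaKernel b 0))

section derivOp

variable {a a' b b' : ℝ} {F : ℝ → ℝ → ℝ}

lemma isBddMeas_derivOp (ha' : 0 < a') (haa' : a' < a) (ha1 : a' < 1) (hb' : 0 < b')
    (hbb' : b' < b) (hb1 : b' < 1) (hF : IsBddMeas F) : IsBddMeas (derivOp a a' b b' F) := by
  have i1 := isUnitKernel_betaKernel (p := a - a') (q := 0) (sub_pos.2 haa') (by norm_num)
  have i2 := isUnitKernel_betaKernel (p := a) (q := 0) (ha'.trans haa') (by norm_num)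
  have i3 := isUnitKernel_marchaudKernel ha' ha1 haa'.le
  have j1 := isUnitKernel_betaKernel (p := b - b') (q := 0) (sub_pos.2 hbb') (by norm_num)
  have j2 := isUnitKernel_betaKernel (p := b) (q := 0) (hb'.trans hbb') (by norm_num)
  have j3 := isUnitKernel_marchaudKernel hb' hb1 hbb'.le
  exact hF.sdil _ _ _ _ _ _

lemma continuousAt_derivOp (ha' : 0 < a') (haa' : a' < a) (ha1 : a' < 1) (hb' : 0 < b')
    (hbb' : b' < b) (hb1 : b' < 1) (hF : IsBddMeas F) :
    (∀ y, ∀ x > 0, ContinuousAt (fun x => derivOp a a' b b' F x y) x) ∧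
      ∀ x, ∀ y > 0, ContinuousAt (fun y => derivOp a a' b b' F x y) y := by
  have i1 := isUnitKernel_betaKernel (p := a - a') (q := 0) (sub_pos.2 haa') (by norm_num)
  have i2 := isUnitKernel_betaKernel (p := a) (q := 0) (ha'.trans haa') (by norm_num)
  have i3 := isUnitKernel_marchaudKernel ha' ha1 haa'.le
  have j1 := isUnitKernel_betaKernel (p := b - b') (q := 0) (sub_pos.2 hbb') (by norm_num)
  have j2 := isUnitKernel_betaKernel (p := b) (q := 0) (hb'.trans hbb') (by norm_num)
  have j3 := isUnitKernel_marchaudKernel hb' hb1 hbb'.le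
  have c1 := isContKernel_betaKernel (p := a - a') (q := 0) (sub_pos.2 haa') (by norm_num)
  have c2 := isContKernel_betaKernel (p := a) (q := 0) (ha'.trans haa') (by norm_num)
  have d1 := isContKernel_betaKernel (p := b - b') (q := 0) (sub_pos.2 hbb') (by norm_num)
  have d2 := isContKernel_betaKernel (p := b) (q := 0) (hb'.trans hbb') (by norm_num)
  exact ⟨fun y x hx => continuousAt_sdil_left hF _ _ c1 c2.mconv y hx,
    fun x y hy => continuousAt_sdil_right hF _ _ d1 d2.mconv x hy⟩

/-- The potential of the weighted fractional integral is a primitive of `derivOp`. -/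
lemma rlPotential_weightMul_rlIntegral (ha' : 0 < a') (haa' : a' < a) (ha1 : a' < 1) (hb' : 0 < b')
    (hbb' : b' < b) (hb1 : b' < 1) (hF : IsBddMeas F) {x y : ℝ} (hx : 0 ≤ x) (hy : 0 ≤ y) :
    rlPotential a' b' (weightMul (a' - a) (b' - b) (rlIntegral a b F)) x y =
      Real.Gamma (1 - a') * Real.Gamma (1 - b') *
        ∫ s in (0 : ℝ)..x, ∫ t in (0 : ℝ)..y, derivOp a a' b b' F s t := by
  rcases eq_or_lt_of_le hx with rfl | hx0
  · simp [rlPotential]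
  rcases eq_or_lt_of_le hy with rfl | hy0
  · simp [rlPotential]
  have ha : 0 < a := ha'.trans haa'
  have hb : 0 < b := hb'.trans hbb'
  have i0 := isUnitKernel_betaKernel (p := 1) (q := 0) one_pos (by norm_num)
  have i1 := isUnitKernel_betaKernel (p := a - a') (q := 0) (sub_pos.2 haa') (by norm_num)
  have i2 := isUnitKernel_betaKernel (p := a) (q := 0) ha (by norm_num)
  have i3 := isUnitKernel_marchaudKernel ha' ha1 haa'.le
  have i4 := isUnitKernel_betaKernel (p := 1 - a') (q := a') (sub_pos.2 ha1) (by linarith)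
  have j1 := isUnitKernel_betaKernel (p := b - b') (q := 0) (sub_pos.2 hbb') (by norm_num)
  have j2 := isUnitKernel_betaKernel (p := b) (q := 0) hb (by norm_num)
  have j3 := isUnitKernel_marchaudKernel hb' hb1 hbb'.le
  have j4 := isUnitKernel_betaKernel (p := 1 - b') (q := b') (sub_pos.2 hb1) (by linarith)
  set E := dil₂ (betaKernel a 0) (betaKernel b 0) F with hE
  have hprim : ∫ s in (0 : ℝ)..x, ∫ t in (0 : ℝ)..y, derivOp a a' b b' F s t =
      rlIntegral 1 1 (derivOp a a' b b' F) x y := by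
    simp [rlIntegral]
  rw [rlPotential_eq_rlIntegral ha1 hb1 hx hy, hprim,
    rlIntegral_congr hx hy (g := weightMul a' b' E),
    rlIntegral_eq_dil₂ (sub_pos.2 ha1) (sub_pos.2 hb1) hx0 hy0,
    rlIntegral_eq_dil₂ one_pos one_pos hx0 hy0,
    dil₂_weightMul (sub_pos.2 ha1) (sub_pos.2 hb1) hx0 hy0, derivOp, dil₂_sdil _ _ _ _ _ _ _ _ hF,
    hE, dil₂_dil₂ _ _ _ _ hF]
  · have hca : 0 ≤ a' / Real.Gamma (1 - a') :=
      div_nonneg ha'.le (Real.Gamma_pos_of_pos (sub_pos.2 ha1)).le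
    have hcb : 0 ≤ b' / Real.Gamma (1 - b') :=
      div_nonneg hb'.le (Real.Gamma_pos_of_pos (sub_pos.2 hb1)).le
    have key := sdil_eq_dil₂ _ _ _ _ hF _ _ (betaKernel_one_mconv_eq ha' ha1 haa')
      (betaKernel_one_mconv_eq hb' hb1 hbb') x y
    rw [Real.coe_toNNReal _ hca, Real.coe_toNNReal _ hcb] at key
    rw [key, ← mul_assoc (x ^ (1 - a') * y ^ (1 - b'))]
    congr 2
    have hx1 : x ^ (1 - a') * x ^ a' = x ^ (1 : ℝ) := by
      rw [← Real.rpow_add hx0, sub_add_cancel]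
    have hy1 : y ^ (1 - b') * y ^ b' = y ^ (1 : ℝ) := by
      rw [← Real.rpow_add hy0, sub_add_cancel]
    rw [← hx1, ← hy1]
    ring
  · intro u hu v hv
    rw [weightMul, rlIntegral_eq_dil₂ ha hb hu.1 hv.1, weightMul, ← hE]
    have hu1 : u ^ (a' - a) * u ^ a = u ^ a' := by rw [← Real.rpow_add hu.1, sub_add_cancel]
    have hv1 : v ^ (b' - b) * v ^ b = v ^ b' := by rw [← Real.rpow_add hv.1, sub_add_cancel]
    rw [← hu1, ← hv1]
    ring

end derivOp

/-! ### The fractional derivative exists -/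

/-- The function equal to `F` on `(0, T]²` and to zero elsewhere. -/
def cutoff (T : ℝ) (F : ℝ → ℝ → ℝ) (x y : ℝ) : ℝ :=
  (Ioc 0 T ×ˢ Ioc 0 T).indicator (Function.uncurry F) (x, y)

lemma cutoff_of_mem {T x y : ℝ} (hx : x ∈ Ioc 0 T) (hy : y ∈ Ioc 0 T) (F : ℝ → ℝ → ℝ) :
    cutoff T F x y = F x y :=
  indicator_of_mem (mk_mem_prod hx hy) _

lemma isBddMeas_cutoff {T M : ℝ} {F : ℝ → ℝ → ℝ} (hF : Measurable (Function.uncurry F))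
    (hM0 : 0 ≤ M) (hM : ∀ x ∈ Ioc 0 T, ∀ y ∈ Ioc 0 T, |F x y| ≤ M) : IsBddMeas (cutoff T F) := by
  refine ⟨hF.indicator (measurableSet_Ioc.prod measurableSet_Ioc), M, fun x y => ?_⟩
  by_cases h : (x, y) ∈ Ioc 0 T ×ˢ Ioc 0 T
  · rw [cutoff_of_mem h.1 h.2]
    exact hM x h.1 y h.2
  · rw [cutoff, indicator_of_notMem h, abs_zero]
    exact hM0

lemma integrableOn_rl_kernel_mul {p q x y : ℝ} (hp : 0 < p) (hq : 0 < q) (hx : 0 ≤ x)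
    (hy : 0 ≤ y) {G : ℝ → ℝ → ℝ} (hG : IsBddMeas G) :
    IntegrableOn (fun z : ℝ × ℝ => (x - z.1) ^ (p - 1) * (y - z.2) ^ (q - 1) * G z.1 z.2)
      (Ioc 0 x ×ˢ Ioc 0 y) := by
  have h1 : ∀ {r s : ℝ}, 0 < r → 0 ≤ s → IntegrableOn (fun u : ℝ => (s - u) ^ (r - 1)) (Ioc 0 s) := by
    intro r s hr hs
    have h := (intervalIntegral.intervalIntegrable_rpow' (a := s) (b := 0) (r := r - 1)
      (by linarith)).comp_sub_left s
    rw [sub_self, sub_zero] at h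
    exact (intervalIntegrable_iff_integrableOn_Ioc_of_le hs).1 h
  obtain ⟨M, hM⟩ := hG.bdd
  rw [IntegrableOn, Measure.volume_eq_prod, ← Measure.prod_restrict]
  exact ((h1 hp hx).mul_prod (h1 hq hy)).mul_bdd (c := M) hG.meas.aestronglyMeasurable
    (Filter.Eventually.of_forall fun z => hM z.1 z.2)

/-- A double primitive of a bounded, separately continuous function has the expected mixed
derivative. -/
lemma hasDerivAt_double_primitive {S : ℝ → ℝ → ℝ} (hS : IsBddMeas S)
    (hl : ∀ y, ∀ x > 0, ContinuousAt (fun x => S x y) x)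
    (hr : ∀ x, ∀ y > 0, ContinuousAt (fun y => S x y) y) {s t : ℝ} (hs : 0 < s) (ht : 0 < t) :
    (∀ x ≥ 0, HasDerivAt (fun y => ∫ u in (0 : ℝ)..x, ∫ v in (0 : ℝ)..y, S u v)
      (∫ u in (0 : ℝ)..x, S u t) t) ∧
    HasDerivAt (fun x => ∫ u in (0 : ℝ)..x, S u t) (S s t) s := by
  obtain ⟨M, hM⟩ := hS.bdd
  have hmeas_left : ∀ y, Measurable fun u => S u y := fun y =>
    hS.meas.comp measurable_prodMk_right
  have hint : ∀ {f : ℝ → ℝ}, Measurable f → ∀ {N : ℝ}, (∀ u, |f u| ≤ N) → ∀ x y : ℝ,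
      IntervalIntegrable f volume x y := fun hf N hN x y =>
    (intervalIntegrable_const (c := N)).mono_fun hf.aestronglyMeasurable
      (Filter.Eventually.of_forall fun u => (hN u).trans (le_abs_self N))
  refine ⟨fun x hx => ?_, ?_⟩
  · set Q : ℝ → ℝ := fun v => ∫ u in (0 : ℝ)..x, S u v with hQ
    have hQ' : ∀ v, Q v = ∫ u, S u v ∂(volume.restrict (Ioc 0 x)) := fun v =>
      intervalIntegral.integral_of_le hx
    have hS' : IsBddMeas fun v u => S u v :=
      hS.comp (f := fun p => p.2) (g := fun p => p.1) (by fun_prop) (by fun_prop)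
    obtain ⟨hQm, N, hN⟩ := integral_bdd_meas hS' (volume.restrict (Ioc 0 x))
    simp only [← hQ'] at hQm hN
    have hQc : ContinuousAt Q t := by
      refine intervalIntegral.continuousAt_of_dominated_interval (bound := fun _ => M)
        (Filter.Eventually.of_forall fun v => (hmeas_left v).aestronglyMeasurable)
        (Filter.Eventually.of_forall fun v => Filter.Eventually.of_forall fun u _ => hM u v)
        intervalIntegrable_const (Filter.Eventually.of_forall fun u _ => hr u t ht)
    have hder := intervalIntegral.integral_hasDerivAt_right (hint hQm hN 0 t)
      hQm.stronglyMeasurable.stronglyMeasurableAtFilter hQc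
    refine hder.congr_of_eventuallyEq ?_
    filter_upwards [Ioi_mem_nhds ht] with y hy
    simp only [hQ', intervalIntegral.integral_of_le hx, intervalIntegral.integral_of_le (le_of_lt hy)]
    exact hS.integral_swap _ _
  · exact intervalIntegral.integral_hasDerivAt_right (hint (hmeas_left t) (fun u => hM u t) 0 s)
      (hmeas_left t).stronglyMeasurable.stronglyMeasurableAtFilter (hl t s hs)

/-- For `f` bounded and Borel on `(0, T]²`, the weighted fractional derivative exists at every
point of `(0, T]²` and is given by `derivOp`. -/
lemma rlDeriv_weightMul_rlIntegral {T a a' b b' : ℝ} (hT : 0 < T) (ha' : 0 < a') (haa' : a' < a)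
    (ha1 : a' < 1) (hb' : 0 < b') (hbb' : b' < b) (hb1 : b' < 1) {f F : ℝ → ℝ → ℝ}
    (hF : IsBddMeas F) (hfF : ∀ x ∈ Ioc 0 T, ∀ y ∈ Ioc 0 T, f x y = F x y) {s t : ℝ}
    (hs : s ∈ Ioc 0 T) (ht : t ∈ Ioc 0 T) :
    RLIntegrableAt a b f s t ∧
    RLDifferentiableAt T a' b' (weightMul (a' - a) (b' - b) (rlIntegral a b f)) s t ∧
    rlDeriv T a' b' (weightMul (a' - a) (b' - b) (rlIntegral a b f)) s t =
      derivOp a a' b b' F s t := by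
  have ha : 0 < a := ha'.trans haa'
  have hb : 0 < b := hb'.trans hbb'
  have i1 := isUnitKernel_betaKernel (p := a) (q := 0) ha (by norm_num)
  have j1 := isUnitKernel_betaKernel (p := b) (q := 0) hb (by norm_num)
  have hsub : ∀ {r : ℝ}, r ∈ Icc 0 T → Ioc 0 r ⊆ Ioc 0 T := fun hr => Ioc_subset_Ioc_right hr.2
  have hI : ∀ x ∈ Icc 0 T, ∀ y ∈ Icc 0 T, rlIntegral a b f x y = rlIntegral a b F x y :=
    fun x hx y hy => rlIntegral_congr hx.1 hy.1 fun u hu v hv =>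
      hfF u (hsub hx hu) v (hsub hy hv)
  set w := weightMul (a' - a) (b' - b) (rlIntegral a b f) with hw
  set S := derivOp a a' b b' F with hSdef
  set c := Real.Gamma (1 - a') * Real.Gamma (1 - b') with hc
  have hc0 : c ≠ 0 := mul_ne_zero (Real.Gamma_pos_of_pos (sub_pos.2 ha1)).ne'
    (Real.Gamma_pos_of_pos (sub_pos.2 hb1)).ne'
  have hpot : ∀ x ∈ Icc 0 T, ∀ y ∈ Icc 0 T, rlPotential a' b' w x y =
      c * ∫ s in (0 : ℝ)..x, ∫ t in (0 : ℝ)..y, S s t := by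
    intro x hx y hy
    rw [← rlPotential_weightMul_rlIntegral ha' haa' ha1 hb' hbb' hb1 hF hx.1 hy.1]
    simp only [rlPotential, intervalIntegral.integral_of_le hx.1,
      intervalIntegral.integral_of_le hy.1]
    refine setIntegral_congr_fun measurableSet_Ioc fun u hu => ?_
    refine setIntegral_congr_fun measurableSet_Ioc fun v hv => ?_
    simp only [hw, weightMul]
    rw [hI u (Ioc_subset_Icc_self (hsub hx hu)) v (Ioc_subset_Icc_self (hsub hy hv))]
  obtain ⟨hl, hr⟩ := continuousAt_derivOp ha' haa' ha1 hb' hbb' hb1 hF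
  obtain ⟨hd1, hd2⟩ := hasDerivAt_double_primitive
    (isBddMeas_derivOp ha' haa' ha1 hb' hbb' hb1 hF) hl hr hs.1 ht.1
  have hsI := Ioc_subset_Icc_self hs
  have htI := Ioc_subset_Icc_self ht
  have hy' : ∀ x ∈ Icc 0 T, HasDerivWithinAt (fun y' => rlPotential a' b' w x y')
      (c * ∫ u in (0 : ℝ)..x, S u t) (Icc 0 T) t := fun x hx =>
    ((hd1 x hx.1).const_mul c).hasDerivWithinAt.congr (fun y hy => hpot x hx y hy)
      (hpot x hx t htI)
  have hdy : ∀ x ∈ Icc 0 T, derivWithin (fun y' => rlPotential a' b' w x y') (Icc 0 T) t =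
      c * ∫ u in (0 : ℝ)..x, S u t := fun x hx =>
    (hy' x hx).derivWithin (uniqueDiffOn_Icc hT t htI)
  have hx' : HasDerivWithinAt
      (fun x => derivWithin (fun y' => rlPotential a' b' w x y') (Icc 0 T) t) (c * S s t)
      (Icc 0 T) s :=
    (hd2.const_mul c).hasDerivWithinAt.congr hdy (hdy s hsI)
  refine ⟨?_, ⟨?_, fun x hx => (hy' x hx).differentiableWithinAt, hx'.differentiableWithinAt⟩, ?_⟩
  · refine (integrableOn_rl_kernel_mul ha hb hs.1.le ht.1.le hF).congr_fun (fun z hz => ?_)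
      (measurableSet_Ioc.prod measurableSet_Ioc)
    simp only [hfF z.1 (hsub hsI hz.1) z.2 (hsub htI hz.2)]
  · intro x hx y hy
    have hE := hF.dil₂ (betaKernel a 0) (betaKernel b 0)
    obtain ⟨M, hM⟩ := hE.bdd
    have hM0 : 0 ≤ M := (abs_nonneg _).trans (hM 0 0)
    have hG : IsBddMeas (cutoff T
        (weightMul a' b' (dil₂ (betaKernel a 0) (betaKernel b 0) F))) := by
      refine isBddMeas_cutoff (M := T ^ a' * T ^ b' * M) ?_ (by positivity) fun u hu v hv => ?_
      · have : Measurable fun p : ℝ × ℝ => p.1 ^ a' * p.2 ^ b' := by fun_prop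
        exact this.mul hE.meas
      · rw [weightMul, abs_mul, abs_of_nonneg (mul_nonneg (Real.rpow_nonneg hu.1.le _)
          (Real.rpow_nonneg hv.1.le _))]
        refine mul_le_mul (mul_le_mul (Real.rpow_le_rpow hu.1.le hu.2 ha'.le)
          (Real.rpow_le_rpow hv.1.le hv.2 hb'.le) (Real.rpow_nonneg hv.1.le _) (by positivity))
          (hM u v) (abs_nonneg _) (by positivity)
    refine (integrableOn_rl_kernel_mul (sub_pos.2 ha1) (sub_pos.2 hb1) hx.1 hy.1 hG).congr_fun
      (fun z hz => ?_) (measurableSet_Ioc.prod measurableSet_Ioc)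
    have hz1 := hsub hx hz.1
    have hz2 := hsub hy hz.2
    simp only
    rw [potential_kernel_eq hz.1.2 hz.2.2, cutoff_of_mem hz1 hz2, hw, weightMul, weightMul,
      hI _ (Ioc_subset_Icc_self hz1) _ (Ioc_subset_Icc_self hz2),
      rlIntegral_eq_dil₂ ha hb hz1.1 hz2.1]
    have hu1 : z.1 ^ (a' - a) * z.1 ^ a = z.1 ^ a' := by
      rw [← Real.rpow_add hz1.1, sub_add_cancel]
    have hv1 : z.2 ^ (b' - b) * z.2 ^ b = z.2 ^ b' := by
      rw [← Real.rpow_add hz2.1, sub_add_cancel]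
    rw [← hu1, ← hv1]
    ring
  · rw [rlDeriv, hx'.derivWithin (uniqueDiffOn_Icc hT s hsI), ← mul_assoc,
      one_div_mul_cancel hc0, one_mul]

/-! ### Estimates for Gamma quotients and Marchaud integrals -/

lemma Gamma_one_add_le_one {x : ℝ} (h0 : 0 ≤ x) (h1 : x ≤ 1) : Real.Gamma (1 + x) ≤ 1 := by
  have h := Real.convexOn_Gamma.2 (show (1 : ℝ) ∈ Ioi 0 by simp) (show (2 : ℝ) ∈ Ioi 0 by simp)
    (sub_nonneg.2 h1) h0 (sub_add_cancel 1 x)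
  simp only [smul_eq_mul, Real.Gamma_one, Real.Gamma_two] at h
  rw [show (1 - x) * 1 + x * 2 = 1 + x by ring] at h
  linarith

/-- Midpoint convexity of `Γ` at `3 / 2`, where its value is `√π / 2`. -/
lemma le_Gamma_one_add {x : ℝ} (h0 : 0 ≤ x) (h1 : x ≤ 1) : (0.72 : ℝ) ≤ Real.Gamma (1 + x) := by
  have h := Real.convexOn_Gamma.2 (show 1 + x ∈ Ioi (0 : ℝ) by simp only [mem_Ioi]; linarith)
    (show 1 + (1 - x) ∈ Ioi (0 : ℝ) by simp only [mem_Ioi]; linarith)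
    one_half_pos.le one_half_pos.le (add_halves (1 : ℝ))
  have h2 := Gamma_one_add_le_one (x := 1 - x) (by linarith) (by linarith)
  have h3 : Real.Gamma (3 / 2) = √Real.pi / 2 := by
    rw [show (3 / 2 : ℝ) = 1 / 2 + 1 by norm_num, Real.Gamma_add_one (by norm_num),
      Real.Gamma_one_half_eq]
    ring
  simp only [smul_eq_mul] at h
  rw [show 1 / 2 * (1 + x) + 1 / 2 * (1 + (1 - x)) = (3 / 2 : ℝ) by ring, h3] at h
  have h4 : (1.72 : ℝ) ≤ √Real.pi := Real.le_sqrt_of_sq_le (by linarith [Real.pi_gt_three])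
  linarith

/-- Wendel's inequality. -/
lemma Gamma_sub_div_mul_rpow_le_one {y r : ℝ} (hy : 0 < y) (hr0 : 0 < r) (hr1 : r < 1) :
    Real.Gamma (y + 1 - r) / Real.Gamma (y + 1) * y ^ r ≤ 1 := by
  have h := Real.Gamma_mul_add_mul_le_rpow_Gamma_mul_rpow_Gamma hy (by linarith : 0 < y + 1) hr0
    (by linarith : 0 < 1 - r) (by ring)
  rw [show r * y + (1 - r) * (y + 1) = y + 1 - r by ring] at h
  have hG := Real.Gamma_pos_of_pos hy
  have hG1 := Real.Gamma_pos_of_pos (by linarith : 0 < y + 1)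
  have hyr := Real.rpow_pos_of_pos hy r
  rw [div_mul_eq_mul_div, div_le_one hG1]
  calc Real.Gamma (y + 1 - r) * y ^ r
      ≤ Real.Gamma y ^ r * Real.Gamma (y + 1) ^ (1 - r) * y ^ r :=
        mul_le_mul_of_nonneg_right h hyr.le
    _ = (y * Real.Gamma y) ^ r * Real.Gamma (y + 1) ^ (1 - r) := by
        rw [Real.mul_rpow hy.le hG.le]; ring
    _ = Real.Gamma (y + 1) := by
        rw [← Real.Gamma_add_one hy.ne', ← Real.rpow_add hG1, add_sub_cancel, Real.rpow_one]

lemma Gamma_div_Gamma_add_le {s r : ℝ} (hs : 0 ≤ s) (hr : 0 < r) :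
    Real.Gamma (s + 1) / Real.Gamma (s + 1 + r) ≤ 1 / Real.Gamma (1 + r) := by
  have i := isUnitKernel_betaKernel (p := r) (q := 0) hr (by norm_num)
  have h := mom_anti (betaKernel r 0) le_rfl hs
  rw [mom_betaKernel hr (by linarith), mom_betaKernel hr (by norm_num)] at h
  simpa using h

lemma marchaud_nonneg {r m : ℝ} (hm : 0 ≤ m) : 0 ≤ marchaud r m :=
  setIntegral_nonneg measurableSet_Ioo fun _ hw =>
    mul_nonneg (sub_nonneg.2 (rpow_le_one_of_mem_Ioo hw hm))
      (Real.rpow_nonneg (sub_nonneg.2 hw.2.le) _)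

/-- The bounds `1 - w ^ m ≤ 1` and `1 - w ^ m ≤ max 1 m * (1 - w)` interpolate to
`1 - w ^ m ≤ (max 1 m * (1 - w)) ^ θ`. -/
lemma marchaud_le {r m θ : ℝ} (hr : r < θ) (hθ0 : 0 ≤ θ) (hθ : θ ≤ 1) (hm : 0 ≤ m) :
    marchaud r m ≤ max 1 m ^ θ / (θ - r) := by
  have hM : 0 ≤ max 1 m := zero_le_one.trans (le_max_left 1 m)
  have hi := integral_one_sub_rpow (r := θ - r - 1) (by linarith)
  rw [sub_add_cancel] at hi
  rw [div_eq_mul_one_div, ← hi, ← integral_const_mul, marchaud]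
  refine setIntegral_mono_on (integrableOn_marchaud (hr.trans_le hθ) hm)
    ((integrableOn_one_sub_rpow (by linarith)).const_mul _) measurableSet_Ioo fun w hw => ?_
  have hw' : 0 < 1 - w := sub_pos.2 hw.2
  have hMw : 0 ≤ max 1 m * (1 - w) := mul_nonneg hM hw'.le
  have h1 : 1 - w ^ m ≤ (max 1 m * (1 - w)) ^ θ := by
    rcases le_total 1 (max 1 m * (1 - w)) with h | h
    · have := Real.one_le_rpow h hθ0
      linarith [Real.rpow_nonneg hw.1.le m]
    · refine (one_sub_rpow_le hw).trans ?_
      rcases eq_or_lt_of_le hMw with h0 | h0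
      · rw [← h0]
        exact Real.rpow_nonneg le_rfl _
      · simpa using Real.rpow_le_rpow_of_exponent_ge h0 h hθ
  rw [Real.mul_rpow hM hw'.le] at h1
  calc (1 - w ^ m) * (1 - w) ^ (-r - 1)
      ≤ max 1 m ^ θ * (1 - w) ^ θ * (1 - w) ^ (-r - 1) :=
        mul_le_mul_of_nonneg_right h1 (Real.rpow_nonneg hw'.le _)
    _ = max 1 m ^ θ * (1 - w) ^ (θ - r - 1) := by
        rw [mul_assoc, ← Real.rpow_add hw']
        congr 2
        ring

/-! ### The constants in one variable -/

lemma gam_succ (a a' : ℝ) (n : ℕ) : gam a a' (n + 1) = gam a a' n + (a - a') := by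
  simp only [gam]
  push_cast
  ring

lemma le_gam {a a' : ℝ} (h : a' ≤ a) (n : ℕ) : a ≤ gam a a' n := by
  have : gam a a' n = a + n * (a - a') := by
    simp only [gam]
    ring
  rw [this]
  linarith [mul_nonneg (n.cast_nonneg (α := ℝ)) (sub_nonneg.2 h)]

lemma dSeq_eq_mom {a a' : ℝ} (h : a' ≤ a) (n : ℕ) :
    dSeq a a' n = mom (marchaudKernel a a') (gam a a' n) := by
  rw [dSeq, intervalIntegral.integral_of_le zero_le_one, integral_Ioc_eq_integral_Ioo, mom,
    marchaudKernel, integral_unitDensity (measurable_marchaudDensity a a')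
      (marchaudDensity_nonneg h)]
  refine setIntegral_congr_fun measurableSet_Ioo fun w hw => ?_
  have h1 : 1 ≤ w ^ (a' - a) :=
    Real.one_le_rpow_of_pos_of_le_one_of_nonpos hw.1 hw.2.le (sub_nonpos.2 h)
  have h2 : alphaSeq a a' n + a - 1 = a + gam a a' n := by
    simp only [alphaSeq]
    ring
  have h3 : w ^ a' = w ^ (a' - a) * w ^ a := by
    rw [← Real.rpow_add hw.1, sub_add_cancel]
  simp only [marchaudDensity]
  rw [abs_sub_comm, abs_of_nonneg (sub_nonneg.2 h1), h2, Real.rpow_add hw.1, h3,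
    show -a' - 1 = -(a' + 1) by ring, Real.rpow_neg (sub_nonneg.2 hw.2.le)]
  ring

lemma dConst_eq {a a' : ℝ} (h0 : 0 < a') (h : a' < a) (h1 : a < 1) :
    dConst a a' = 1 / (a - a') + marchaud a' a := by
  have hi := integral_one_sub_rpow (r := a - a' - 1) (by linarith)
  rw [sub_add_cancel] at hi
  rw [dConst, intervalIntegral.integral_of_le zero_le_one, integral_Ioc_eq_integral_Ioo, ← hi,
    marchaud, ← integral_add (integrableOn_one_sub_rpow (by linarith))
      (integrableOn_marchaud (by linarith) (by linarith))]
  refine setIntegral_congr_fun measurableSet_Ioo fun w hw => ?_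
  have hw' : 0 < 1 - w := sub_pos.2 hw.2
  have h2 : 0 ≤ 1 - w ^ a := sub_nonneg.2 (rpow_le_one_of_mem_Ioo hw (h0.trans h).le)
  rw [abs_of_pos hw', abs_of_nonneg h2, show a - a' - 1 = a + -(a' + 1) by ring,
    Real.rpow_add hw' a (-(a' + 1)), show -a' - 1 = -(a' + 1) by ring, Real.rpow_neg hw'.le]
  ring

section OneVariable

variable {a a' : ℝ} (h0 : 0 < a') (h : a' < a) (h1 : a < 1 / 2)
include h0 h h1

lemma dSeq_nonneg (n : ℕ) : 0 ≤ dSeq a a' n := by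
  have i := isUnitKernel_marchaudKernel h0 (by linarith) h.le
  rw [dSeq_eq_mom h.le]
  exact mom_nonneg _ _

lemma dSeq_add_le_dConst (n : ℕ) : 1 / (a - a') + dSeq a a' n ≤ dConst a a' := by
  have i := isUnitKernel_marchaudKernel h0 (by linarith) h.le
  have hg : 0 ≤ gam a a' n := (h0.trans h).le.trans (le_gam h.le n)
  have h2 := mom_anti (marchaudKernel a a') le_rfl hg
  rw [mom_marchaudKernel_eq h0 (by linarith) h.le le_rfl, zero_add, zero_add] at h2
  have h3 := marchaud_nonneg (r := a') h0.le
  rw [dConst_eq h0 h (by linarith), dSeq_eq_mom h.le]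
  linarith

lemma Gamma_quotient_mul_max_rpow_le {g : ℝ} (hg : 0 ≤ g) :
    Real.Gamma (g + 1) / Real.Gamma (g + 1 + a) * Real.Gamma (1 + a) * max 1 (g + a) ^ a ≤ 1 := by
  have ha : 0 < a := h0.trans h
  have hG := Real.Gamma_pos_of_pos (by linarith : 0 < 1 + a)
  rcases le_total (g + a) 1 with hm | hm
  · rw [max_eq_left hm, Real.one_rpow, mul_one, ← le_div_iff₀ hG]
    exact Gamma_div_Gamma_add_le hg ha
  · rw [max_eq_right hm, mul_right_comm]
    have := Gamma_sub_div_mul_rpow_le_one (y := g + a) (r := a) (by linarith) ha (by linarith)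
    rw [show g + a + 1 - a = g + 1 by ring, show g + a + 1 = g + 1 + a by ring] at this
    exact mul_le_one₀ this hG.le (Gamma_one_add_le_one ha.le (by linarith))

lemma Gamma_quotient_mul_marchaud_le {g : ℝ} (hg : 0 ≤ g) :
    Real.Gamma (g + 1) / Real.Gamma (g + 1 + a) * Real.Gamma (1 + a) * marchaud a' (g + a) ≤
      1 / (a - a') := by
  have ha : 0 < a := h0.trans h
  have hA := Real.Gamma_pos_of_pos (by linarith : 0 < g + 1)
  have hB := Real.Gamma_pos_of_pos (by linarith : 0 < g + 1 + a)
  have hG := Real.Gamma_pos_of_pos (by linarith : 0 < 1 + a)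
  refine (mul_le_mul_of_nonneg_left
    (marchaud_le h ha.le (by linarith) (by linarith : 0 ≤ g + a)) (by positivity)).trans ?_
  rw [← mul_div_assoc]
  exact div_le_div_of_nonneg_right (Gamma_quotient_mul_max_rpow_le h0 h h1 hg) (sub_pos.2 h).le

/-- The exponent `2 a` in the interpolation of `marchaud_le` gains the factor `2` that compensates
for values of `Γ` below `1`. -/
lemma Gamma_quotients_mul_marchaud_le {g : ℝ} (hg : 0 ≤ g) :
    Real.Gamma (g + 1) / Real.Gamma (g + 1 + a) * Real.Gamma (1 + a) *
      (Real.Gamma (g + a + 1 - a') / Real.Gamma (g + 1 + (2 * a - a'))) * marchaud a' (g + a) ≤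
      1 / Real.Gamma (1 + a) / (2 * (a - a')) := by
  have ha : 0 < a := h0.trans h
  have hA := Real.Gamma_pos_of_pos (by linarith : 0 < g + 1)
  have hB := Real.Gamma_pos_of_pos (by linarith : 0 < g + 1 + a)
  have hG := Real.Gamma_pos_of_pos (by linarith : 0 < 1 + a)
  have hP1 := Real.Gamma_pos_of_pos (by linarith : 0 < g + a + 1 - a')
  have hP2 := Real.Gamma_pos_of_pos (by linarith : 0 < g + 1 + (2 * a - a'))
  have hM : 0 < max 1 (g + a) := lt_max_of_lt_left one_pos
  have hP : Real.Gamma (g + a + 1 - a') / Real.Gamma (g + 1 + (2 * a - a')) *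
      max 1 (g + a) ^ a ≤ 1 / Real.Gamma (1 + a) := by
    rcases le_total (g + a) 1 with hm | hm
    · rw [max_eq_left hm, Real.one_rpow, mul_one]
      have := Gamma_div_Gamma_add_le (s := g + (a - a')) (r := a) (by linarith) ha
      rwa [show g + (a - a') + 1 = g + a + 1 - a' by ring,
        show g + a + 1 - a' + a = g + 1 + (2 * a - a') by ring] at this
    · rw [max_eq_right hm]
      have h2 := Gamma_sub_div_mul_rpow_le_one (y := g + a + (a - a')) (r := a) (by linarith) ha
        (by linarith)
      rw [show g + a + (a - a') + 1 - a = g + a + 1 - a' by ring,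
        show g + a + (a - a') + 1 = g + 1 + (2 * a - a') by ring] at h2
      have h3 : (g + a) ^ a ≤ (g + a + (a - a')) ^ a :=
        Real.rpow_le_rpow (by linarith) (by linarith) ha.le
      refine ((mul_le_mul_of_nonneg_left h3 (by positivity)).trans h2).trans ?_
      rw [le_div_iff₀ hG, one_mul]
      exact Gamma_one_add_le_one ha.le (by linarith)
  have hW : marchaud a' (g + a) ≤ max 1 (g + a) ^ a * max 1 (g + a) ^ a / (2 * (a - a')) := by
    refine (marchaud_le (θ := 2 * a) (by linarith) (by linarith) (by linarith)
      (by linarith : 0 ≤ g + a)).trans ?_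
    rw [← Real.rpow_add hM, ← two_mul]
    exact div_le_div_of_nonneg_left (Real.rpow_nonneg hM.le _) (by linarith) (by linarith)
  refine (mul_le_mul_of_nonneg_left hW (by positivity)).trans ?_
  rw [← mul_div_assoc]
  refine div_le_div_of_nonneg_right ?_ (by linarith)
  have := mul_le_mul (Gamma_quotient_mul_max_rpow_le h0 h h1 hg) hP (by positivity) zero_le_one
  rw [one_mul] at this
  refine le_trans (le_of_eq ?_) this
  ring

end OneVariable

/-! ### The recursion for the constants -/

section Algebra

variable {a' b' u v A0 B0 P P' Wa Wb d1 d2 Da Db ga gb : ℝ}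

/-- The comparison of constants behind `mul_bounds_le_rSeq`. The Marchaud formula `hA`, `hB` splits
`A` and `B`, and the terms that arise are absorbed by the summand with `Da` and `Db`: the part `ea`
of `Da` pays for `Wa`, and the part `d1` for the term with `d1 * d2`. -/
lemma marchaud_product_le (ha' : 0 ≤ a') (hb' : 0 ≤ b') (hu : 0 ≤ u) (hv : 0 ≤ v) (hA0 : 0 ≤ A0)
    (hB0 : 0 ≤ B0) (hWa : 0 ≤ Wa) (hWb : 0 ≤ Wb) (hd1 : 0 ≤ d1) (hd2 : 0 ≤ d2) (hga : 0 < ga)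
    (hgb : 0 < gb) {A B ea eb : ℝ} (hA : A = A0 * u * (1 + a' * Wa))
    (hB : B = B0 * v * (1 + b' * Wb)) (hAg : A0 * ga ≤ 1) (hBg : B0 * gb ≤ 1)
    (hAW : A0 * ga * Wa ≤ ea) (hBW : B0 * gb * Wb ≤ eb) (hDa : ea + d1 ≤ Da)
    (hDb : eb + d2 ≤ Db) :
    (A + a' * u * (d1 * A0)) * (B + b' * v * (d2 * B0)) ≤
      (1 + a' * b' * (u * v) * d1 * d2) * (A * B) +
        (a' * (u * v) * d1 + b' * (u * v) * d2) * (A0 * B0) +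
        a' * u * (b' * v) * (Db * d1 + Da * d2) / (ga * gb) := by
  have h1 : A0 * ga * Wa * (B0 * gb) ≤ ea :=
    (mul_le_of_le_one_right (by positivity) hBg).trans hAW
  have h2 : B0 * gb * Wb * (A0 * ga) ≤ eb :=
    (mul_le_of_le_one_right (by positivity) hAg).trans hBW
  have h3 : A0 * ga * (B0 * gb) ≤ 1 := mul_le_one₀ hAg (by positivity) hBg
  have key : d2 * (A0 * B0 * Wa) + d1 * (A0 * B0 * Wb) + d1 * d2 * (A0 * B0) ≤
      (Db * d1 + Da * d2) / (ga * gb) := by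
    rw [le_div_iff₀ (mul_pos hga hgb)]
    calc (d2 * (A0 * B0 * Wa) + d1 * (A0 * B0 * Wb) + d1 * d2 * (A0 * B0)) * (ga * gb)
        = d2 * (A0 * ga * Wa * (B0 * gb)) + d1 * (B0 * gb * Wb * (A0 * ga)) +
          d1 * d2 * (A0 * ga * (B0 * gb)) := by ring
      _ ≤ d2 * ea + d1 * eb + d1 * d2 * 1 := by gcongr
      _ = (ea + d1) * d2 + eb * d1 := by ring
      _ ≤ Da * d2 + Db * d1 := by
          have : eb ≤ Db := by linarith
          gcongr
      _ = Db * d1 + Da * d2 := by ring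
  have hK : 0 ≤ a' * u * (b' * v) := by positivity
  have hAB : 0 ≤ a' * b' * (u * v) * d1 * d2 * (A * B) := by
    rw [hA, hB]
    positivity
  have e : (A + a' * u * (d1 * A0)) * (B + b' * v * (d2 * B0)) =
      A * B + (a' * (u * v) * d1 + b' * (u * v) * d2) * (A0 * B0) +
        a' * u * (b' * v) *
          (d2 * (A0 * B0 * Wa) + d1 * (A0 * B0 * Wb) + d1 * d2 * (A0 * B0)) := by
    rw [hA, hB]
    ring
  rw [e, mul_div_assoc]
  linarith [mul_le_mul_of_nonneg_left key hK]

/-- The comparison of constants behind `mul_bounds_le_mSeq`. The terms that arise from the constant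
part of the Marchaud formula `hR`, `hR'` are bounded with `Z ≤ Cs`, those with the integrals `Wa`
and `Wb` with the other bound on `Z`. -/
lemma marchaud_product_le' (ha' : 0 ≤ a') (hb' : 0 ≤ b') (hu : 0 ≤ u) (hv : 0 ≤ v) (hP : 0 ≤ P)
    (hP' : 0 ≤ P') (hWa : 0 ≤ Wa) (hWb : 0 ≤ Wb) (hd1 : 0 ≤ d1) (hd2 : 0 ≤ d2) (hga : 0 < ga)
    (hgb : 0 < gb) {R R' Z C Cs : ℝ} (hR : R = P * u * (1 + a' * Wa))
    (hR' : R' = P' * v * (1 + b' * Wb)) (hC : 0 ≤ C) (hZCs : Z ≤ Cs)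
    (hZC : Z ≤ C * (A0 * B0)) (hDa : A0 * ga * P * Wa * (B0 * gb * P') ≤ Da)
    (hDb : B0 * gb * P' * Wb * (A0 * ga * P) ≤ Db) :
    Z * ((R + a' * u * (P * d1)) * (R' + b' * v * (P' * d2))) ≤
      (R * R' + P * P' * (a' * (u * v) * d1 + b' * (u * v) * d2 + a' * b' * (u * v) * d1 * d2)) *
        Cs + a' * u * (b' * v) * (Db * d1 + Da * d2) / (ga * gb) * C := by
  have key : A0 * B0 * (P * P' * (d2 * Wa + d1 * Wb)) ≤ (Db * d1 + Da * d2) / (ga * gb) := by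
    rw [le_div_iff₀ (mul_pos hga hgb)]
    calc A0 * B0 * (P * P' * (d2 * Wa + d1 * Wb)) * (ga * gb)
        = B0 * gb * P' * Wb * (A0 * ga * P) * d1 + A0 * ga * P * Wa * (B0 * gb * P') * d2 := by
          ring
      _ ≤ Db * d1 + Da * d2 := by gcongr
  have hK : 0 ≤ a' * u * (b' * v) := by positivity
  have hQ : 0 ≤ R * R' +
      P * P' * (a' * (u * v) * d1 + b' * (u * v) * d2 + a' * b' * (u * v) * d1 * d2) := by
    rw [hR, hR']
    positivity
  have hQ2 : 0 ≤ P * P' * (d2 * Wa + d1 * Wb) := by positivity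
  have e : Z * ((R + a' * u * (P * d1)) * (R' + b' * v * (P' * d2))) =
      (R * R' + P * P' * (a' * (u * v) * d1 + b' * (u * v) * d2 + a' * b' * (u * v) * d1 * d2)) *
        Z + a' * u * (b' * v) * (Z * (P * P' * (d2 * Wa + d1 * Wb))) := by
    rw [hR, hR']
    ring
  have h2 : Z * (P * P' * (d2 * Wa + d1 * Wb)) ≤ (Db * d1 + Da * d2) / (ga * gb) * C := by
    calc Z * (P * P' * (d2 * Wa + d1 * Wb))
        ≤ C * (A0 * B0) * (P * P' * (d2 * Wa + d1 * Wb)) := mul_le_mul_of_nonneg_right hZC hQ2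
      _ = C * (A0 * B0 * (P * P' * (d2 * Wa + d1 * Wb))) := by ring
      _ ≤ C * ((Db * d1 + Da * d2) / (ga * gb)) := mul_le_mul_of_nonneg_left key hC
      _ = (Db * d1 + Da * d2) / (ga * gb) * C := mul_comm _ _
  rw [e, mul_div_assoc, mul_assoc (a' * u * (b' * v))]
  exact add_le_add (mul_le_mul_of_nonneg_left hZCs hQ) (mul_le_mul_of_nonneg_left h2 hK)

end Algebra

section Constants

variable {a a' b b' : ℝ}

lemma lSeq_eq (ha : a ≠ 0) (hb : b ≠ 0) (n : ℕ) :
    lSeq a a' b b' n = a' * (1 / Real.Gamma (1 - a')) * (b' * (1 / Real.Gamma (1 - b'))) *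
      (dConst b b' * dSeq a a' n + dConst a a' * dSeq b b' n) /
        (Real.Gamma (1 + a) * Real.Gamma (1 + b)) := by
  rw [lSeq, c3, add_comm 1 a, add_comm 1 b, Real.Gamma_add_one ha, Real.Gamma_add_one hb]
  congr 1
  · rw [← div_eq_mul_one_div, ← div_eq_mul_one_div, div_mul_div_comm]
  · ring

variable (ha0 : 0 < a') (haa : a' < a) (ha1 : a < 1 / 2)
  (hb0 : 0 < b') (hbb : b' < b) (hb1 : b < 1 / 2)
include ha0 haa ha1 hb0 hbb hb1

/-- The product of the one-variable bounds of the two factors of `derivOp` is at most `r_n`. -/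
lemma mul_bounds_le_rSeq (n : ℕ) :
    (Real.Gamma (alphaSeq a a' n) / Real.Gamma (alphaSeq a a' n + a - a') +
        a' / Real.Gamma (1 - a') * (dSeq a a' n *
          (Real.Gamma (alphaSeq a a' n) / Real.Gamma (alphaSeq a a' n + a)))) *
      (Real.Gamma (alphaSeq b b' n) / Real.Gamma (alphaSeq b b' n + b - b') +
        b' / Real.Gamma (1 - b') * (dSeq b b' n *
          (Real.Gamma (alphaSeq b b' n) / Real.Gamma (alphaSeq b b' n + b)))) ≤
      rSeq a a' b b' n := by
  have one : ∀ {a a' : ℝ}, 0 < a' → a' < a → a < 1 / 2 →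
      0 ≤ Real.Gamma (alphaSeq a a' n) / Real.Gamma (alphaSeq a a' n + a) ∧
      0 ≤ 1 / Real.Gamma (1 - a') ∧ 0 < Real.Gamma (1 + a) ∧
      0 ≤ marchaud a' (gam a a' n + a) ∧
      Real.Gamma (alphaSeq a a' n) / Real.Gamma (alphaSeq a a' n + a - a') =
        Real.Gamma (alphaSeq a a' n) / Real.Gamma (alphaSeq a a' n + a) *
          (1 / Real.Gamma (1 - a')) * (1 + a' * marchaud a' (gam a a' n + a)) ∧
      Real.Gamma (alphaSeq a a' n) / Real.Gamma (alphaSeq a a' n + a) * Real.Gamma (1 + a) ≤ 1 ∧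
      Real.Gamma (alphaSeq a a' n) / Real.Gamma (alphaSeq a a' n + a) * Real.Gamma (1 + a) *
        marchaud a' (gam a a' n + a) ≤ 1 / (a - a') := by
    intro a a' h0 h h1
    have ha : 0 < a := h0.trans h
    have hg : 0 ≤ gam a a' n := ha.le.trans (le_gam h.le n)
    have p0 := Real.Gamma_pos_of_pos (by linarith : 0 < gam a a' n + 1)
    have p1 := Real.Gamma_pos_of_pos (by linarith : 0 < gam a a' n + 1 + a)
    have p2 := Real.Gamma_pos_of_pos (by linarith : 0 < 1 - a')
    have p3 := Real.Gamma_pos_of_pos (by linarith : 0 < 1 + a)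
    have p4 := Real.Gamma_pos_of_pos (by linarith : 0 < gam a a' n + 1 + a - a')
    simp only [alphaSeq]
    refine ⟨by positivity, by positivity, p3, marchaud_nonneg (by linarith), ?_, ?_,
      Gamma_quotient_mul_marchaud_le h0 h h1 hg⟩
    · have hm := marchaud_eq (r := a') (m := gam a a' n + a) (by linarith) (by linarith)
      rw [show gam a a' n + a + 1 = gam a a' n + 1 + a by ring] at hm
      rw [hm]
      field_simp
      ring
    · rw [← le_div_iff₀ p3]
      exact Gamma_div_Gamma_add_le hg ha
  obtain ⟨a1, a2, a3, a4, a5, a6, a7⟩ := one ha0 haa ha1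
  obtain ⟨b1, b2, b3, b4, b5, b6, b7⟩ := one hb0 hbb hb1
  have := marchaud_product_le ha0.le hb0.le a2 b2 a1 b1 a4 b4 (dSeq_nonneg ha0 haa ha1 n)
    (dSeq_nonneg hb0 hbb hb1 n) a3 b3 a5 b5 a6 b6 a7 b7 (dSeq_add_le_dConst ha0 haa ha1 n)
    (dSeq_add_le_dConst hb0 hbb hb1 n)
  rw [← lSeq_eq (ha0.trans haa).ne' (hb0.trans hbb).ne'] at this
  rw [rSeq, kapTilde, kap, c1, c2, c3]
  refine le_trans (le_of_eq ?_) (this.trans (le_of_eq ?_))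
  · simp only [← div_eq_mul_one_div]
  · simp only [div_eq_mul_inv, mul_inv, one_mul]

/-- The analogous bound for the operator that `derivOp` induces on fractional integrals. The
constant `Z` stands for a bound on a fractional integral that is at most the bound `Cs` and at most
the bound that follows from the bound `C` on the function itself. -/
lemma mul_bounds_le_mSeq (n : ℕ) {Z C Cs : ℝ} (hC : 0 ≤ C) (hZCs : Z ≤ Cs)
    (hZC : Z ≤ C * (Real.Gamma (alphaSeq a a' n) / Real.Gamma (alphaSeq a a' n + a) *
      (Real.Gamma (alphaSeq b b' n) / Real.Gamma (alphaSeq b b' n + b)))) :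
    Z * ((Real.Gamma (alphaSeq a a' n + a) / Real.Gamma (alphaSeq a a' n + 2 * a - a') +
        a' / Real.Gamma (1 - a') * (Real.Gamma (alphaSeq a a' n + a - a') /
          Real.Gamma (alphaSeq a a' n + 2 * a - a') * dSeq a a' n)) *
      (Real.Gamma (alphaSeq b b' n + b) / Real.Gamma (alphaSeq b b' n + 2 * b - b') +
        b' / Real.Gamma (1 - b') * (Real.Gamma (alphaSeq b b' n + b - b') /
          Real.Gamma (alphaSeq b b' n + 2 * b - b') * dSeq b b' n))) ≤
      mSeq a a' b b' n * Cs + lSeq a a' b b' n * C := by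
  have one : ∀ {a a' : ℝ}, 0 < a' → a' < a → a < 1 / 2 →
      (0 ≤ Real.Gamma (alphaSeq a a' n + a - a') / Real.Gamma (alphaSeq a a' n + 2 * a - a') ∧
      0 ≤ 1 / Real.Gamma (1 - a') ∧ (0.72 : ℝ) ≤ Real.Gamma (1 + a) ∧
      0 ≤ marchaud a' (gam a a' n + a)) ∧
      Real.Gamma (alphaSeq a a' n + a) / Real.Gamma (alphaSeq a a' n + 2 * a - a') =
        Real.Gamma (alphaSeq a a' n + a - a') / Real.Gamma (alphaSeq a a' n + 2 * a - a') *
          (1 / Real.Gamma (1 - a')) * (1 + a' * marchaud a' (gam a a' n + a)) ∧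
      0 ≤ Real.Gamma (alphaSeq a a' n) / Real.Gamma (alphaSeq a a' n + a) * Real.Gamma (1 + a) *
        (Real.Gamma (alphaSeq a a' n + a - a') / Real.Gamma (alphaSeq a a' n + 2 * a - a')) ∧
      Real.Gamma (alphaSeq a a' n) / Real.Gamma (alphaSeq a a' n + a) * Real.Gamma (1 + a) *
        (Real.Gamma (alphaSeq a a' n + a - a') / Real.Gamma (alphaSeq a a' n + 2 * a - a')) ≤
          1 / Real.Gamma (1 + a) ∧
      Real.Gamma (alphaSeq a a' n) / Real.Gamma (alphaSeq a a' n + a) * Real.Gamma (1 + a) *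
        (Real.Gamma (alphaSeq a a' n + a - a') / Real.Gamma (alphaSeq a a' n + 2 * a - a')) *
        marchaud a' (gam a a' n + a) ≤ 1 / Real.Gamma (1 + a) / (2 * (a - a')) := by
    intro a a' h0 h h1
    have ha : 0 < a := h0.trans h
    have hg : 0 ≤ gam a a' n := ha.le.trans (le_gam h.le n)
    have p0 := Real.Gamma_pos_of_pos (by linarith : 0 < gam a a' n + 1)
    have p1 := Real.Gamma_pos_of_pos (by linarith : 0 < gam a a' n + 1 + a)
    have p2 := Real.Gamma_pos_of_pos (by linarith : 0 < 1 - a')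
    have p3 := Real.Gamma_pos_of_pos (by linarith : 0 < 1 + a)
    have p4 := Real.Gamma_pos_of_pos (by linarith : 0 < gam a a' n + 1 + a - a')
    have p5 := Real.Gamma_pos_of_pos (by linarith : 0 < gam a a' n + 1 + 2 * a - a')
    have q1 := Gamma_div_Gamma_add_le hg ha
    have q2 := Gamma_div_Gamma_add_le (s := gam a a' n + (a - a')) (by linarith) ha
    rw [show gam a a' n + (a - a') + 1 = gam a a' n + 1 + a - a' by ring,
      show gam a a' n + 1 + a - a' + a = gam a a' n + 1 + 2 * a - a' by ring] at q2
    have q3 := Gamma_quotients_mul_marchaud_le h0 h h1 hg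
    rw [show gam a a' n + a + 1 - a' = gam a a' n + 1 + a - a' by ring,
      show gam a a' n + 1 + (2 * a - a') = gam a a' n + 1 + 2 * a - a' by ring] at q3
    rw [le_div_iff₀ p3] at q1
    simp only [alphaSeq]
    refine ⟨⟨by positivity, by positivity, le_Gamma_one_add ha.le (by linarith),
      marchaud_nonneg (by linarith)⟩, ?_, by positivity, ?_, q3⟩
    · have hm := marchaud_eq (r := a') (m := gam a a' n + a) (by linarith) (by linarith)
      rw [show gam a a' n + a + 1 = gam a a' n + 1 + a by ring] at hm
      rw [hm]
      field_simp
      ring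
    · exact (mul_le_of_le_one_left (by positivity) q1).trans q2
  obtain ⟨⟨a1, a2, a3, a4⟩, a5, a6, a7, a8⟩ := one ha0 haa ha1
  obtain ⟨⟨b1, b2, b3, b4⟩, b5, b6, b7, b8⟩ := one hb0 hbb hb1
  have hga : 0 < Real.Gamma (1 + a) := by linarith
  have hgb : 0 < Real.Gamma (1 + b) := by linarith
  have hgg : 1 / Real.Gamma (1 + a) * (1 / Real.Gamma (1 + b)) ≤ 2 := by
    rw [one_div_mul_one_div, div_le_iff₀ (mul_pos hga hgb)]
    have := mul_le_mul a3 b3 (by norm_num) hga.le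
    linarith
  have cross : ∀ {x y g g' e D : ℝ}, 0 ≤ y → 0 ≤ g → 0 < e → x ≤ g / (2 * e) → y ≤ g' →
      g * g' ≤ 2 → 1 / e ≤ D → x * y ≤ D := by
    intro x y g g' e D hy hg he hx hyg hgg hD
    calc x * y ≤ g / (2 * e) * g' := mul_le_mul hx hyg hy (by positivity)
      _ = g * g' / (2 * e) := by ring
      _ ≤ 2 / (2 * e) := div_le_div_of_nonneg_right hgg (by positivity)
      _ = 1 / e := by field_simp
      _ ≤ D := hD
  have hd1 := dSeq_nonneg ha0 haa ha1 n
  have hd2 := dSeq_nonneg hb0 hbb hb1 n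
  have hDa := dSeq_add_le_dConst ha0 haa ha1 n
  have hDb := dSeq_add_le_dConst hb0 hbb hb1 n
  have hDa' : 1 / (a - a') ≤ dConst a a' := by linarith
  have hDb' : 1 / (b - b') ≤ dConst b b' := by linarith
  have hgg' : 1 / Real.Gamma (1 + b) * (1 / Real.Gamma (1 + a)) ≤ 2 := by rwa [mul_comm]
  have := marchaud_product_le' ha0.le hb0.le a2 b2 a1 b1 a4 b4 hd1 hd2 hga hgb a5 b5 hC hZCs hZC
    (cross b6 (by positivity) (sub_pos.2 haa) a8 b7 hgg hDa')
    (cross a6 (by positivity) (sub_pos.2 hbb) b8 a7 hgg' hDb')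
  rw [← lSeq_eq (ha0.trans haa).ne' (hb0.trans hbb).ne'] at this
  rw [mSeq, kapTildePrime, kapPrime, c1, c2, c3]
  refine le_trans (le_of_eq ?_) (this.trans (le_of_eq ?_))
  · simp only [← div_eq_mul_one_div]
  · simp only [div_eq_mul_inv, mul_inv, one_mul]

lemma rSeq_nonneg (n : ℕ) : 0 ≤ rSeq a a' b b' n := by
  refine le_trans ?_ (mul_bounds_le_rSeq ha0 haa ha1 hb0 hbb hb1 n)
  have one : ∀ {a a' : ℝ}, 0 < a' → a' < a → a < 1 / 2 →
      0 ≤ Real.Gamma (alphaSeq a a' n) / Real.Gamma (alphaSeq a a' n + a - a') +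
        a' / Real.Gamma (1 - a') * (dSeq a a' n *
          (Real.Gamma (alphaSeq a a' n) / Real.Gamma (alphaSeq a a' n + a))) := by
    intro a a' h0 h h1
    have hg := le_gam h.le n
    have p0 := Real.Gamma_pos_of_pos (by linarith : 0 < gam a a' n + 1)
    have p1 := Real.Gamma_pos_of_pos (by linarith : 0 < gam a a' n + 1 + a)
    have p2 := Real.Gamma_pos_of_pos (by linarith : 0 < 1 - a')
    have p4 := Real.Gamma_pos_of_pos (by linarith : 0 < gam a a' n + 1 + a - a')
    have hd := dSeq_nonneg h0 h h1 n
    simp only [alphaSeq]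
    positivity
  exact mul_nonneg (one ha0 haa ha1) (one hb0 hbb hb1)

lemma CSeq_nonneg {N : ℝ} (hN : 0 ≤ N) (n : ℕ) : 0 ≤ CSeq a a' b b' N n := by
  induction n with
  | zero => exact hN
  | succ n ih => exact mul_nonneg (rSeq_nonneg ha0 haa ha1 hb0 hbb hb1 n) ih

end Constants

/-! ### The induction -/

lemma dil₂_congr {m n : Measure ℝ} [IsUnitKernel m] [IsUnitKernel n] {T x y : ℝ}
    {F G : ℝ → ℝ → ℝ} (h : ∀ x ∈ Ioc 0 T, ∀ y ∈ Ioc 0 T, F x y = G x y) (hx : x ∈ Ioc 0 T)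
    (hy : y ∈ Ioc 0 T) : dil₂ m n F x y = dil₂ m n G x y := by
  refine integral_congr_ae ?_
  filter_upwards [IsUnitKernel.ae_mem (m := m)] with w hw
  refine integral_congr_ae ?_
  filter_upwards [IsUnitKernel.ae_mem (m := n)] with z hz
  exact h _ ⟨mul_pos hx.1 hw.1, (mul_le_of_le_one_right hx.1.le hw.2.le).trans hx.2⟩
    _ ⟨mul_pos hy.1 hz.1, (mul_le_of_le_one_right hy.1.le hz.2.le).trans hy.2⟩

/-- The averages of `x^(a-a') y^(b-b') derivOp F` in terms of the averages of `F`: fractional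
integration is moved past the operator, so that bounds on the fractional integral of `F` can be
used. -/
lemma dil₂_weightMul_derivOp {a a' b b' : ℝ} (ha0 : 0 < a') (haa : a' < a) (ha1 : a' < 1)
    (hb0 : 0 < b') (hbb : b' < b) (hb1 : b' < 1) {F : ℝ → ℝ → ℝ} (hF : IsBddMeas F) {x y : ℝ}
    (hx : 0 < x) (hy : 0 < y) :
    dil₂ (betaKernel a 0) (betaKernel b 0)
        (weightMul (a - a') (b - b') (derivOp a a' b b' F)) x y =
      x ^ (a - a') * y ^ (b - b') *
        sdil (a' / Real.Gamma (1 - a')) (b' / Real.Gamma (1 - b'))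
          (betaKernel (a - a') a) ((betaKernel a (a - a')).mconv (marchaudKernel a a'))
          (betaKernel (b - b') b) ((betaKernel b (b - b')).mconv (marchaudKernel b b'))
          (dil₂ (betaKernel a 0) (betaKernel b 0) F) x y := by
  have ha : 0 < a := ha0.trans haa
  have hb : 0 < b := hb0.trans hbb
  have ea : 0 < a - a' := sub_pos.2 haa
  have eb : 0 < b - b' := sub_pos.2 hbb
  have i1 := isUnitKernel_betaKernel (p := a - a') (q := 0) ea (by norm_num)
  have i2 := isUnitKernel_betaKernel (p := a) (q := 0) ha (by norm_num)
  have i3 := isUnitKernel_marchaudKernel ha0 ha1 haa.le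
  have i4 := isUnitKernel_betaKernel (p := a - a') (q := a) ea (by linarith)
  have i5 := isUnitKernel_betaKernel (p := a) (q := a - a') ha (by linarith)
  have j1 := isUnitKernel_betaKernel (p := b - b') (q := 0) eb (by norm_num)
  have j2 := isUnitKernel_betaKernel (p := b) (q := 0) hb (by norm_num)
  have j3 := isUnitKernel_marchaudKernel hb0 hb1 hbb.le
  have j4 := isUnitKernel_betaKernel (p := b - b') (q := b) eb (by linarith)
  have j5 := isUnitKernel_betaKernel (p := b) (q := b - b') hb (by linarith)
  rw [dil₂_weightMul ha hb hx hy, derivOp, dil₂_sdil _ _ _ _ _ _ _ _ hF,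
    ← sdil_mconv _ _ _ _ _ _ _ _ hF, betaKernel_mconv_swap ha ea, betaKernel_mconv_swap hb eb,
    Measure.mconv_assoc, Measure.mconv_assoc]

/-- The weighted Gamma moments that occur as one-variable bounds. -/
lemma moments_derivOp {a a' : ℝ} (h0 : 0 < a') (h : a' < a) (h1 : a < 1 / 2) (n : ℕ) :
    mom (betaKernel a 0) (gam a a' n) =
      Real.Gamma (alphaSeq a a' n) / Real.Gamma (alphaSeq a a' n + a) ∧
    mom (betaKernel (a - a') 0) (gam a a' n) =
      Real.Gamma (alphaSeq a a' n) / Real.Gamma (alphaSeq a a' n + a - a') ∧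
    mom ((marchaudKernel a a').mconv (betaKernel a 0)) (gam a a' n) = dSeq a a' n *
      (Real.Gamma (alphaSeq a a' n) / Real.Gamma (alphaSeq a a' n + a)) ∧
    mom (betaKernel (a - a') a) (gam a a' n) =
      Real.Gamma (alphaSeq a a' n + a) / Real.Gamma (alphaSeq a a' n + 2 * a - a') ∧
    mom ((betaKernel a (a - a')).mconv (marchaudKernel a a')) (gam a a' n) =
      Real.Gamma (alphaSeq a a' n + a - a') / Real.Gamma (alphaSeq a a' n + 2 * a - a') *
        dSeq a a' n := by
  have ha : 0 < a := h0.trans h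
  have ea : 0 < a - a' := sub_pos.2 h
  have hg : 0 ≤ gam a a' n := ha.le.trans (le_gam h.le n)
  have i2 := isUnitKernel_betaKernel (p := a) (q := 0) ha (by norm_num)
  have i3 := isUnitKernel_marchaudKernel h0 (by linarith) h.le
  have i5 := isUnitKernel_betaKernel (p := a) (q := a - a') ha (by linarith)
  have m1 : mom (betaKernel a 0) (gam a a' n) =
      Real.Gamma (alphaSeq a a' n) / Real.Gamma (alphaSeq a a' n + a) := by
    rw [mom_betaKernel ha (by linarith), zero_add, alphaSeq]
  refine ⟨m1, ?_, ?_, ?_, ?_⟩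
  · rw [mom_betaKernel ea (by linarith), zero_add, alphaSeq, add_sub_assoc]
  · rw [mom_mconv _ _ hg, m1, dSeq_eq_mom h.le]
  · rw [mom_betaKernel ea (by linarith), alphaSeq]
    congr 2 <;> ring
  · rw [mom_mconv _ _ hg, mom_betaKernel ha (by linarith), dSeq_eq_mom h.le, alphaSeq]
    congr 3 <;> ring

/-- The statement carried through the induction: on `(0, T]²` the function `f` agrees with a
bounded Borel function `F` that satisfies the power bound with constant `C`, and whose averages
`x^(-a) y^(-b) I^{a,b} F` satisfy it with constant `Cs`. -/
def Controlled (T a a' b b' : ℝ) (n : ℕ) (f : ℝ → ℝ → ℝ) (C Cs : ℝ) : Prop :=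
  ∃ F, IsBddMeas F ∧ (∀ x ∈ Ioc 0 T, ∀ y ∈ Ioc 0 T, f x y = F x y) ∧
    (∀ x ∈ Ioc 0 T, ∀ y ∈ Ioc 0 T, |F x y| ≤ C * x ^ gam a a' n * y ^ gam b b' n) ∧
    ∀ x ∈ Ioc 0 T, ∀ y ∈ Ioc 0 T, |dil₂ (betaKernel a 0) (betaKernel b 0) F x y| ≤
      Cs * x ^ gam a a' n * y ^ gam b b' n

lemma fSeq_succ (T a a' b b' : ℝ) (h : ℝ → ℝ → ℝ) (n : ℕ) :
    fSeq T a a' b b' h (n + 1) = weightMul (a - a') (b - b')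
      (rlDeriv T a' b' (weightMul (a' - a) (b' - b)
        (rlIntegral a b (fSeq T a a' b b' h n)))) := by
  rw [fSeq, Function.iterate_succ_apply', neumannOp]
  rfl

lemma controlled_zero {T a b : ℝ} (hT : 0 < T) (ha : 0 < a) (hb : 0 < b) (a' b' : ℝ) {h : ℝ → ℝ → ℝ} (hmeas : Measurable (Function.uncurry h)) {N : ℝ}
    (hN : ∀ x ∈ Icc 0 T, ∀ y ∈ Icc 0 T, |h x y| ≤ N) :
    Controlled T a a' b b' 0 (fSeq T a a' b b' h 0) (CSeq a a' b b' N 0)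
      (CStarSeq a a' b b' N 0) := by
  have i2 := isUnitKernel_betaKernel (p := a) (q := 0) ha (by norm_num)
  have j2 := isUnitKernel_betaKernel (p := b) (q := 0) hb (by norm_num)
  have hN0 : 0 ≤ N := (abs_nonneg _).trans (hN T ⟨hT.le, le_rfl⟩ T ⟨hT.le, le_rfl⟩)
  have ga : gam a a' 0 = a := by simp [gam]
  have gb : gam b b' 0 = b := by simp [gam]
  have hbd : ∀ x ∈ Ioc 0 T, ∀ y ∈ Ioc 0 T, |weightMul a b h x y| ≤ N * x ^ a * y ^ b := by
    intro x hx y hy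
    have hx' := Real.rpow_nonneg hx.1.le a
    have hy' := Real.rpow_nonneg hy.1.le b
    rw [weightMul, abs_mul, abs_of_nonneg (mul_nonneg hx' hy')]
    refine (mul_le_mul_of_nonneg_left (hN x (Ioc_subset_Icc_self hx) y (Ioc_subset_Icc_self hy))
      (mul_nonneg hx' hy')).trans_eq ?_
    ring
  have hm : Measurable (Function.uncurry (weightMul a b h)) := by
    have h1 : Measurable fun p : ℝ × ℝ => p.1 ^ a * p.2 ^ b := by fun_prop
    exact h1.mul hmeas
  rw [Controlled, ga, gb, CSeq, CStarSeq]
  refine ⟨cutoff T (weightMul a b h), isBddMeas_cutoff (M := N * T ^ a * T ^ b) hm (by positivity)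
    fun x hx y hy => (hbd x hx y hy).trans ?_, fun x hx y hy => ?_, fun x hx y hy => ?_,
    fun x hx y hy => ?_⟩
  · have hx1 := Real.rpow_le_rpow hx.1.le hx.2 ha.le
    have hy1 := Real.rpow_le_rpow hy.1.le hy.2 hb.le
    have hy0 := Real.rpow_nonneg hy.1.le b
    gcongr
  · have hx1 : x ^ (a - a') * x ^ a' = x ^ a := by rw [← Real.rpow_add hx.1, sub_add_cancel]
    have hy1 : y ^ (b - b') * y ^ b' = y ^ b := by rw [← Real.rpow_add hy.1, sub_add_cancel]
    rw [cutoff_of_mem hx hy, fSeq, Function.iterate_zero, id, weightMul, weightMul, weightMul,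
      ← hx1, ← hy1]
    ring
  · rw [cutoff_of_mem hx hy]
    exact hbd x hx y hy
  · rw [dil₂_congr (fun x hx y hy => cutoff_of_mem hx hy (weightMul a b h)) hx hy]
    refine (abs_dil₂_le _ _ ha.le hb.le hbd hx hy).trans_eq ?_
    rw [mom_betaKernel ha (by linarith), mom_betaKernel hb (by linarith), zero_add, zero_add,
      show a + 1 + a = 2 * a + 1 by ring, show b + 1 + b = 2 * b + 1 by ring,
      Real.Gamma_add_one ha.ne', Real.Gamma_add_one hb.ne',
      Real.Gamma_add_one (by positivity : 2 * a ≠ 0),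
      Real.Gamma_add_one (by positivity : 2 * b ≠ 0)]
    have p1 := (Real.Gamma_pos_of_pos (by positivity : 0 < 2 * a)).ne'
    have p2 := (Real.Gamma_pos_of_pos (by positivity : 0 < 2 * b)).ne'
    field_simp
    ring

section Induction

variable {T a a' b b' : ℝ} (hT : 0 < T) (ha0 : 0 < a') (haa : a' < a) (ha1 : a < 1 / 2)
  (hb0 : 0 < b') (hbb : b' < b) (hb1 : b < 1 / 2)
include hT ha0 haa ha1 hb0 hbb hb1

lemma controlled_succ {n : ℕ} {f : ℝ → ℝ → ℝ} {C Cs : ℝ} (hC : 0 ≤ C)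
    (hf : Controlled T a a' b b' n f C Cs) :
    Controlled T a a' b b' (n + 1)
      (weightMul (a - a') (b - b')
        (rlDeriv T a' b' (weightMul (a' - a) (b' - b) (rlIntegral a b f))))
      (rSeq a a' b b' n * C) (mSeq a a' b b' n * Cs + lSeq a a' b b' n * C) := by
  obtain ⟨F, hF, hfF, hFC, hFCs⟩ := hf
  have ha : 0 < a := ha0.trans haa
  have hb : 0 < b := hb0.trans hbb
  have ea : 0 < a - a' := sub_pos.2 haa
  have eb : 0 < b - b' := sub_pos.2 hbb
  have ha1' : a' < 1 := by linarith
  have hb1' : b' < 1 := by linarith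
  have i1 := isUnitKernel_betaKernel (p := a - a') (q := 0) ea (by norm_num)
  have i2 := isUnitKernel_betaKernel (p := a) (q := 0) ha (by norm_num)
  have i3 := isUnitKernel_marchaudKernel ha0 ha1' haa.le
  have i4 := isUnitKernel_betaKernel (p := a - a') (q := a) ea (by linarith)
  have i5 := isUnitKernel_betaKernel (p := a) (q := a - a') ha (by linarith)
  have j1 := isUnitKernel_betaKernel (p := b - b') (q := 0) eb (by norm_num)
  have j2 := isUnitKernel_betaKernel (p := b) (q := 0) hb (by norm_num)
  have j3 := isUnitKernel_marchaudKernel hb0 hb1' hbb.le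
  have j4 := isUnitKernel_betaKernel (p := b - b') (q := b) eb (by linarith)
  have j5 := isUnitKernel_betaKernel (p := b) (q := b - b') hb (by linarith)
  have hga : 0 ≤ gam a a' n := ha.le.trans (le_gam haa.le n)
  have hgb : 0 ≤ gam b b' n := hb.le.trans (le_gam hbb.le n)
  have hca : 0 ≤ a' / Real.Gamma (1 - a') :=
    div_nonneg ha0.le (Real.Gamma_pos_of_pos (sub_pos.2 ha1')).le
  have hcb : 0 ≤ b' / Real.Gamma (1 - b') :=
    div_nonneg hb0.le (Real.Gamma_pos_of_pos (sub_pos.2 hb1')).le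
  obtain ⟨ma1, ma2, ma3, ma4, ma5⟩ := moments_derivOp ha0 haa ha1 n
  obtain ⟨mb1, mb2, mb3, mb4, mb5⟩ := moments_derivOp hb0 hbb hb1 n
  have hr := rSeq_nonneg ha0 haa ha1 hb0 hbb hb1 n
  set F' := weightMul (a - a') (b - b') (derivOp a a' b b' F) with hF'
  -- the factor `x^(a-a') y^(b-b')` raises the exponents from step `n` to step `n + 1`
  have hpow : ∀ x ∈ Ioc 0 T, ∀ y ∈ Ioc 0 T, ∀ K r : ℝ, |r| ≤ K * x ^ gam a a' n * y ^ gam b b' n →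
      |x ^ (a - a') * y ^ (b - b') * r| ≤
        K * x ^ gam a a' (n + 1) * y ^ gam b b' (n + 1) := by
    intro x hx y hy K r hKr
    have hx' := Real.rpow_nonneg hx.1.le (a - a')
    have hy' := Real.rpow_nonneg hy.1.le (b - b')
    rw [gam_succ, gam_succ, Real.rpow_add hx.1, Real.rpow_add hy.1, abs_mul,
      abs_of_nonneg (mul_nonneg hx' hy')]
    refine (mul_le_mul_of_nonneg_left hKr (mul_nonneg hx' hy')).trans_eq ?_
    ring
  have hF'C : ∀ x ∈ Ioc 0 T, ∀ y ∈ Ioc 0 T, |F' x y| ≤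
      rSeq a a' b b' n * C * x ^ gam a a' (n + 1) * y ^ gam b b' (n + 1) := by
    intro x hx y hy
    refine hpow x hx y hy _ _ ((abs_sdil_le hca hcb _ _ _ _ hga hgb hFC hx hy).trans ?_)
    rw [ma2, ma3, mb2, mb3]
    have hx' := Real.rpow_nonneg hx.1.le (gam a a' n)
    have hy' := Real.rpow_nonneg hy.1.le (gam b b' n)
    refine (mul_le_mul_of_nonneg_left (mul_bounds_le_rSeq ha0 haa ha1 hb0 hbb hb1 n)
      (by positivity)).trans_eq ?_
    ring
  have hF'meas : Measurable (Function.uncurry F') := by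
    have h1 : Measurable fun p : ℝ × ℝ => p.1 ^ (a - a') * p.2 ^ (b - b') := by fun_prop
    exact h1.mul (isBddMeas_derivOp ha0 haa ha1' hb0 hbb hb1' hF).meas
  refine ⟨cutoff T F', isBddMeas_cutoff (M := rSeq a a' b b' n * C * T ^ gam a a' (n + 1) *
    T ^ gam b b' (n + 1)) hF'meas (by positivity) fun x hx y hy => (hF'C x hx y hy).trans ?_,
    fun x hx y hy => ?_, fun x hx y hy => ?_, fun x hx y hy => ?_⟩
  · have hga' : 0 ≤ gam a a' (n + 1) := ha.le.trans (le_gam haa.le _)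
    have hgb' : 0 ≤ gam b b' (n + 1) := hb.le.trans (le_gam hbb.le _)
    have hx1 := Real.rpow_le_rpow hx.1.le hx.2 hga'
    have hy1 := Real.rpow_le_rpow hy.1.le hy.2 hgb'
    have hy0 := Real.rpow_nonneg hy.1.le (gam b b' (n + 1))
    gcongr
  · rw [cutoff_of_mem hx hy, hF', weightMul, weightMul,
      (rlDeriv_weightMul_rlIntegral hT ha0 haa ha1' hb0 hbb hb1' hF hfF hx hy).2.2]
  · rw [cutoff_of_mem hx hy]
    exact hF'C x hx y hy
  · rw [dil₂_congr (fun x hx y hy => cutoff_of_mem hx hy F') hx hy, hF',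
      dil₂_weightMul_derivOp ha0 haa ha1' hb0 hbb hb1' hF hx.1 hy.1]
    -- the averages of `F` obey the better of the bound `Cs` and the one inherited from `F`
    set Z := min Cs (C * (Real.Gamma (alphaSeq a a' n) / Real.Gamma (alphaSeq a a' n + a) *
      (Real.Gamma (alphaSeq b b' n) / Real.Gamma (alphaSeq b b' n + b)))) with hZ
    have hE : ∀ x ∈ Ioc 0 T, ∀ y ∈ Ioc 0 T, |dil₂ (betaKernel a 0) (betaKernel b 0) F x y| ≤
        Z * x ^ gam a a' n * y ^ gam b b' n := by
      intro x hx y hy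
      have hx' := Real.rpow_nonneg hx.1.le (gam a a' n)
      have hy' := Real.rpow_nonneg hy.1.le (gam b b' n)
      rcases min_choice Cs (C * (Real.Gamma (alphaSeq a a' n) /
        Real.Gamma (alphaSeq a a' n + a) * (Real.Gamma (alphaSeq b b' n) /
          Real.Gamma (alphaSeq b b' n + b)))) with h | h
      · rw [hZ, h]
        exact hFCs x hx y hy
      · rw [hZ, h, ← ma1, ← mb1]
        refine (abs_dil₂_le _ _ hga hgb hFC hx hy).trans_eq ?_
        ring
    refine hpow x hx y hy _ _ ((abs_sdil_le hca hcb _ _ _ _ hga hgb hE hx hy).trans ?_)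
    rw [ma4, ma5, mb4, mb5]
    have hx' := Real.rpow_nonneg hx.1.le (gam a a' n)
    have hy' := Real.rpow_nonneg hy.1.le (gam b b' n)
    have := mul_bounds_le_mSeq ha0 haa ha1 hb0 hbb hb1 n hC (min_le_left _ _ : Z ≤ Cs)
      (min_le_right _ _)
    refine le_trans (le_of_eq ?_)
      (mul_le_mul_of_nonneg_right (mul_le_mul_of_nonneg_right this hx') hy')
    ring

lemma controlled_fSeq {h : ℝ → ℝ → ℝ} (hmeas : Measurable (Function.uncurry h)) {N : ℝ}
    (hN : ∀ x ∈ Icc 0 T, ∀ y ∈ Icc 0 T, |h x y| ≤ N) (n : ℕ) :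
    Controlled T a a' b b' n (fSeq T a a' b b' h n) (CSeq a a' b b' N n)
      (CStarSeq a a' b b' N n) := by
  have hN0 : 0 ≤ N := (abs_nonneg _).trans (hN T ⟨hT.le, le_rfl⟩ T ⟨hT.le, le_rfl⟩)
  induction n with
  | zero => exact controlled_zero hT (ha0.trans haa) (hb0.trans hbb) a' b' hmeas hN
  | succ n ih =>
    rw [fSeq_succ]
    exact controlled_succ hT ha0 haa ha1 hb0 hbb hb1
      (CSeq_nonneg ha0 haa ha1 hb0 hbb hb1 hN0 n) ih

end Induction

end

theorem mainTheorem8 (T a a' b b' : ℝ) (hT : 0 < T)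
    (ha' : 0 < a') (haa' : a' < a) (ha : a < 1 / 2)
    (hb' : 0 < b') (hbb' : b' < b) (hb : b < 1 / 2)
    (h : ℝ → ℝ → ℝ) (hmeas : Measurable (Function.uncurry h))
    (hbdd : BddAbove ((fun z : ℝ × ℝ => |h z.1 z.2|) '' (Icc 0 T ×ˢ Icc 0 T))) :
    (∀ n : ℕ, ∀ s ∈ Ioc 0 T, ∀ t ∈ Ioc 0 T,
      RLIntegrableAt a b (fSeq T a a' b b' h n) s t ∧
      RLDifferentiableAt T a' b'
        (weightMul (a' - a) (b' - b) (GSeq T a a' b b' h n)) s t) ∧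
    (∀ n : ℕ, ∀ s ∈ Icc 0 T, ∀ t ∈ Icc 0 T,
      |fSeq T a a' b b' h n s t| ≤
        CSeq a a' b b' (supNormSquare T h) n * s ^ (gam a a' n) * t ^ (gam b b' n)) ∧
    (∀ n : ℕ, ∀ s ∈ Icc 0 T, ∀ t ∈ Icc 0 T,
      JSeq T a a' b b' h n s t ≤
        CStarSeq a a' b b' (supNormSquare T h) n * s ^ (gam a a' n) * t ^ (gam b b' n)) := by
  have hN : ∀ x ∈ Icc 0 T, ∀ y ∈ Icc 0 T, |h x y| ≤ supNormSquare T h := fun x hx y hy =>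
    le_csSup hbdd ⟨(x, y), ⟨hx, hy⟩, rfl⟩
  have ha0 : 0 < a := ha'.trans haa'
  have hb0 : 0 < b := hb'.trans hbb'
  have hctrl := controlled_fSeq hT ha' haa' ha hb' hbb' hb hmeas hN
  have hga : ∀ n, gam a a' n ≠ 0 := fun n => (ha0.trans_le (le_gam haa'.le n)).ne'
  have hgb : ∀ n, gam b b' n ≠ 0 := fun n => (hb0.trans_le (le_gam hbb'.le n)).ne'
  refine ⟨fun n s hs t ht => ?_, fun n s hs t ht => ?_, fun n s hs t ht => ?_⟩
  · obtain ⟨F, hF, hfF, -, -⟩ := hctrl n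
    have := rlDeriv_weightMul_rlIntegral hT ha' haa' (by linarith) hb' hbb' (by linarith) hF hfF
      hs ht
    exact ⟨this.1, this.2.1⟩
  · obtain ⟨F, -, hfF, hFC, -⟩ := hctrl n
    rcases eq_or_lt_of_le hs.1 with rfl | hs0
    · simp [fSeq, weightMul, Real.zero_rpow (sub_pos.2 haa').ne', Real.zero_rpow (hga n)]
    rcases eq_or_lt_of_le ht.1 with rfl | ht0
    · simp [fSeq, weightMul, Real.zero_rpow (sub_pos.2 hbb').ne', Real.zero_rpow (hgb n)]
    rw [hfF s ⟨hs0, hs.2⟩ t ⟨ht0, ht.2⟩]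
    exact hFC s ⟨hs0, hs.2⟩ t ⟨ht0, ht.2⟩
  · obtain ⟨F, -, hfF, -, hFCs⟩ := hctrl n
    rcases eq_or_lt_of_le hs.1 with rfl | hs0
    · simp [JSeq, Real.zero_rpow (neg_ne_zero.2 ha0.ne'), Real.zero_rpow (hga n)]
    rcases eq_or_lt_of_le ht.1 with rfl | ht0
    · simp [JSeq, Real.zero_rpow (neg_ne_zero.2 hb0.ne'), Real.zero_rpow (hgb n)]
    refine le_trans (le_of_eq ?_) (hFCs s ⟨hs0, hs.2⟩ t ⟨ht0, ht.2⟩)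
    have hI : GSeq T a a' b b' h n s t = rlIntegral a b F s t :=
      rlIntegral_congr hs.1 ht.1 fun u hu v hv =>
        hfF u ⟨hu.1, hu.2.trans hs.2⟩ v ⟨hv.1, hv.2.trans ht.2⟩
    have p1 := Real.rpow_pos_of_pos hs0 a
    have p2 := Real.rpow_pos_of_pos ht0 b
    rw [JSeq, hI, rlIntegral_eq_dil₂ ha0 hb0 hs0 ht0, abs_mul, abs_of_pos (mul_pos p1 p2),
      Real.rpow_neg hs.1, Real.rpow_neg ht.1]
    field_simp
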